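/- Let $L$ and $N$ be integers with $0<N<L$. Consider the two-sided topological Markov chain (Markov shift) whose states are the configurations of $N$ stones placed in distinct holes of the discrete circle $\mathbb{Z}/L\mathbb{Z}$, a transition being allowed exactly when one stone moves from its hole $i$ to the next hole $i+1$ (mod $L$), which must be empty, while all other stones stay. Its topological entropy is $$h=\log\frac{\sin\frac{\pi N}{L}}{\sin\frac{\pi}{L}}.$$ The chain has a unique measure of maximal entropy $\mu$ (a shift-invariant probability measure on the space of allowed two-sided trajectories, of maximal Kolmogorov--Sinai entropy), and the distribution of the state at a given time under $\mu$ is determinantal: for any $N$ consecutive discrete Fourier harmonics $v_r=\big(e^{-2\pi i r j/L}\big)_{j\in\mathbb{Z}/L\mathbb{Z}}$, $r=a,a+1,\dots,a+N-1$ (with $a\in\mathbb{Z}$ arbitrary), if $K=(K(j,k))_{j,k\in\mathbb{Z}/L\mathbb{Z}}$ is the matrix of the orthogonal projection of $\mathbb{C}^L$ onto their span, then for every set $A\subseteq\mathbb{Z}/L\mathbb{Z}$ $$\mu(\text{all holes of } A \text{ are occupied by stones})=\det\big(K(j,k)\big)_{j,k\in A}.$$ -/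

import Mathlib

open MeasureTheory Filter

noncomputable section

namespace ModifiedTASEP

/-! ### Kolmogorov--Sinai entropy -/

/-- Shannon entropy (natural logarithm) of the finite partition of `Ω` into the level sets of `f`,
`H(f) = - ∑ i, μ(f = i) log μ(f = i)`. -/
def partitionEntropy {Ω ι : Type*} [MeasurableSpace Ω] [Fintype ι] (μ : Measure Ω) (f : Ω → ι) :
    ℝ :=
  ∑ i, Real.negMulLog (μ.real (f ⁻¹' {i}))

/-- The itinerary of length `n` of a point: `(f x, f (T x), …, f (T^(n-1) x))`. Its level sets are
the atoms of the refinement of the partitions `T^(-i) f`, `0 ≤ i < n`. -/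
def itinerary {Ω ι : Type*} (T : Ω → Ω) (f : Ω → ι) (n : ℕ) (x : Ω) : Fin n → ι :=
  fun i => f (T^[i] x)

/-- Entropy of `T` relative to the finite partition `f`: the asymptotic value of `H_n / n`, where
`H_n` is the Shannon entropy of the `n`-th refinement. -/
def entropyOfPartition {Ω ι : Type*} [MeasurableSpace Ω] [Fintype ι] (μ : Measure Ω) (T : Ω → Ω)
    (f : Ω → ι) : EReal :=
  limsup (fun n : ℕ => ((partitionEntropy μ (itinerary T f n) / n : ℝ) : EReal)) atTop

/-- The Kolmogorov--Sinai entropy of `T` with respect to `μ`: the supremum over all finite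
measurable partitions. -/
def measureEntropy {Ω : Type*} [MeasurableSpace Ω] (μ : Measure Ω) (T : Ω → Ω) : EReal :=
  ⨆ (k : ℕ) (f : Ω → Fin k) (_ : Measurable f), entropyOfPartition μ T f

/-! ### Topological Markov chains -/

/-- The left shift on two-sided sequences. -/
def shift {S : Type*} (x : ℤ → S) : ℤ → S := fun n => x (n + 1)

/-- The phase space of the two-sided topological Markov chain with allowed transitions `R`. -/
def pathSpace {S : Type*} (R : S → S → Prop) : Set (ℤ → S) := {x | ∀ n, R (x n) (x (n + 1))}

/-- Shift-invariant probability measures carried by the phase space of the chain. -/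
structure IsInvariantProb {S : Type*} [MeasurableSpace S] (R : S → S → Prop)
    (μ : Measure (ℤ → S)) : Prop where
  isProbabilityMeasure : IsProbabilityMeasure μ
  measurePreserving : MeasurePreserving shift μ μ
  ae_mem : ∀ᵐ x ∂μ, x ∈ pathSpace R

/-- Measures of maximal entropy of the topological Markov chain with allowed transitions `R`. -/
def IsMaximalEntropyMeasure {S : Type*} [MeasurableSpace S] (R : S → S → Prop)
    (μ : Measure (ℤ → S)) : Prop :=
  IsInvariantProb R μ ∧ ∀ ν, IsInvariantProb R ν → measureEntropy ν shift ≤ measureEntropy μ shift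

/-! ### The modified TASEP -/

/-- Configurations of `N` stones on the circle `ℤ/L`. -/
def State (L N : ℕ) : Type := {s : Finset (ZMod L) // s.card = N}

instance (L N : ℕ) : UniformSpace (State L N) := ⊥

instance (L N : ℕ) : MeasurableSpace (State L N) := ⊤

/-- `t` is obtained from `s` by moving one stone to the next hole in the positive direction, this
hole being empty. -/
def Jump (L N : ℕ) (s t : State L N) : Prop :=
  ∃ i ∈ s.1, i + 1 ∉ s.1 ∧ t.1 = insert (i + 1) (s.1.erase i)

/-! ### Determinantal measures and the Fourier kernel -/

/-- The law of the random finite set `X` is determinantal with correlation kernel `K`. -/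
def IsDeterminantal {Ω V : Type*} [MeasurableSpace Ω] [DecidableEq V] (μ : Measure Ω)
    (X : Ω → Finset V) (K : Matrix V V ℂ) : Prop :=
  ∀ A : Finset V, ((μ.real {ω | A ⊆ X ω} : ℝ) : ℂ) =
    (K.submatrix (Subtype.val : A → V) (Subtype.val : A → V)).det

/-- The `r`-th discrete Fourier harmonic `j ↦ exp(-2πi r j / L)` on the circle `ℤ/L`. -/
def harmonic (L : ℕ) (r : ℤ) : EuclideanSpace ℂ (ZMod L) :=
  WithLp.toLp 2 fun j => Complex.exp (-(2 * Real.pi * Complex.I * r * (j.val : ℂ) / L))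

/-- The span of the `N` consecutive harmonics with indices `a, a + 1, …, a + N - 1`. -/
def harmonicSpan (L N : ℕ) (a : ℤ) : Submodule ℂ (EuclideanSpace ℂ (ZMod L)) :=
  Submodule.span ℂ (harmonic L '' Set.Ico a (a + N))

/-- The matrix, in the standard basis, of the orthogonal projection onto the span of the `N`
consecutive harmonics starting at `a`. -/
def harmonicKernel (L N : ℕ) [NeZero L] (a : ℤ) : Matrix (ZMod L) (ZMod L) ℂ :=
  Matrix.of fun j k => (harmonicSpan L N a).starProjection (EuclideanSpace.single k 1) j

end ModifiedTASEP

end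

noncomputable section

namespace ModifiedTASEP

set_option linter.unusedSectionVars false

/-! ### Shannon entropy of finite partitions -/

/-! The jump relation has an explicit Perron eigenvector. Place the holes at the `L`-th roots of
unity and let `chordProduct s` be the product of the distances between the stones, the modulus of a
Vandermonde determinant. With `q = exp (2πi/L)`, moving the stone `z` one hole on replaces each
factor `z - w` by `q z - w`, and the ratio of the two always has phase `exp (πi/L)`, whatever `z`
and `w` are. So the sum of `chordProduct` over all moves, divided by `chordProduct s`, is up to a
phase the interpolation sum of `one_add_mul_sum_prod_div`, namely `(q ^ N - 1) / (q - 1)`. Stripping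
the phase leaves the eigenvalue `lam = sin (πN/L) / sin (π/L)` (`sum_prod_chord_div`). Illegal moves
do not disturb this, because colliding stones make the product vanish. Reflecting the circle
reverses jumps, so the same vector is a left eigenvector (`sum_jump_left`), and every configuration
is reachable from the packed one.

The dynamical part holds for any finite chain with such data (`IsPerronData`, with eigenvectors `l`
and `r`). The Parry chain has transitions `r t / (lam * r s)` and stationary law `l * r`; an allowed
word with `n` transitions has weight `l(first) r(last) / lam ^ n`. This counts the allowed words and
gives topological entropy `log lam` (`coverEntropy_eq`). For an arbitrary invariant measure, one
more letter raises the word entropy by `log lam` minus the relative entropy of its transitions with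
respect to the Parry transitions (`increment_eq`). Word entropies are concave in the length, so the
Kolmogorov--Sinai entropy is at most every increment. By Gibbs' inequality it is at most `log lam`,
and equality forces the Parry transitions, hence the Parry measure. The bound on Kolmogorov--Sinai
entropy by word entropies (`measureEntropy_shift_le`) comes from approximating an arbitrary finite
partition by cylinders.

A state `s` therefore has probability proportional to `chordProduct s ^ 2`. Consecutive harmonics
restricted to `N` holes form a Vandermonde matrix up to unimodular row factors, so these squares
are, up to the factor `L ^ N`, the `N × N` principal minors of the Fourier kernel, for every
starting frequency. For a projection of rank `N`, the size-`N` principal minors containing `A` add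
up to the minor at `A` (`sum_principalMinor_eq`), which is the determinantal formula. -/

lemma negMulLog_add_le {x y : ℝ} (hx : 0 ≤ x) (hy : 0 ≤ y) :
    Real.negMulLog (x + y) ≤ Real.negMulLog x + Real.negMulLog y := by
  rcases hx.eq_or_lt with rfl | hx
  · simp
  rcases hy.eq_or_lt with rfl | hy
  · simp
  have h1 : Real.log x ≤ Real.log (x + y) := Real.log_le_log hx (by linarith)
  have h2 : Real.log y ≤ Real.log (x + y) := Real.log_le_log hy (by linarith)
  simp only [Real.negMulLog]
  nlinarith

lemma negMulLog_sum_le {ι : Type*} (s : Finset ι) (p : ι → ℝ) (hp : ∀ i, 0 ≤ p i) :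
    Real.negMulLog (∑ i ∈ s, p i) ≤ ∑ i ∈ s, Real.negMulLog (p i) := by
  classical
  induction s using Finset.induction_on with
  | empty => simp
  | insert a s ha ih =>
    rw [Finset.sum_insert ha, Finset.sum_insert ha]
    exact (negMulLog_add_le (hp a) (Finset.sum_nonneg fun i _ => hp i)).trans (by linarith)

/-- The mutual information of a nonnegative array is nonnegative. -/
lemma sum_negMulLog_add_negMulLog_sum_le {α β : Type*} [Fintype α] [Fintype β] (p : α → β → ℝ)
    (hp : ∀ a b, 0 ≤ p a b) :
    ∑ a, ∑ b, Real.negMulLog (p a b) + Real.negMulLog (∑ a, ∑ b, p a b) ≤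
      ∑ a, Real.negMulLog (∑ b, p a b) + ∑ b, Real.negMulLog (∑ a, p a b) := by
  set T := ∑ a, ∑ b, p a b with hT
  set r : α → ℝ := fun a => ∑ b, p a b with hr
  set c : β → ℝ := fun b => ∑ a, p a b with hc
  have hr0 : ∀ a, 0 ≤ r a := fun a => Finset.sum_nonneg fun b _ => hp a b
  have hc0 : ∀ b, 0 ≤ c b := fun b => Finset.sum_nonneg fun a _ => hp a b
  have hrT : ∑ a, r a = T := rfl
  have hcT : ∑ b, c b = T := Finset.sum_comm
  have hpr : ∀ a b, p a b ≤ r a := fun a b =>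
    Finset.single_le_sum (f := p a) (fun b _ => hp a b) (Finset.mem_univ b)
  have hpc : ∀ a b, p a b ≤ c b := fun a b =>
    Finset.single_le_sum (f := fun a => p a b) (fun a _ => hp a b) (Finset.mem_univ a)
  have hrTle : ∀ a, r a ≤ T := fun a =>
    Finset.single_le_sum (f := r) (fun a _ => hr0 a) (Finset.mem_univ a)
  have hT0 : 0 ≤ T := Finset.sum_nonneg fun a _ => hr0 a
  -- This is `log t ≤ t - 1` at `t = r a * c b / (T * p a b)`, multiplied by `p a b`. After
  -- summation the last two terms cancel, since `p` and `r * c / T` have the same total mass `T`.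
  have key : ∀ a b, Real.negMulLog (p a b) ≤
      -(p a b * Real.log (r a)) - p a b * Real.log (c b) + p a b * Real.log T - p a b
        + r a * c b / T := by
    intro a b
    rcases (hp a b).eq_or_lt with h | h
    · rw [← h]
      simpa using div_nonneg (mul_nonneg (hr0 a) (hc0 b)) hT0
    · have h1 := h.trans_le (hpr a b)
      have h2 := h.trans_le (hpc a b)
      have h3 := h1.trans_le (hrTle a)
      have h4 := Real.log_le_sub_one_of_pos (x := r a * c b / (T * p a b)) (by positivity)
      rw [Real.log_div (by positivity) (by positivity), Real.log_mul h1.ne' h2.ne',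
        Real.log_mul h3.ne' h.ne'] at h4
      have h5 := mul_le_mul_of_nonneg_left h4 h.le
      have h6 : p a b * (r a * c b / (T * p a b) - 1) = r a * c b / T - p a b := by
        field_simp
      rw [h6] at h5
      simp only [Real.negMulLog]
      linarith
  have hsum := Finset.sum_le_sum fun a (_ : a ∈ Finset.univ) =>
    Finset.sum_le_sum fun b (_ : b ∈ Finset.univ) => key a b
  have e1 : ∑ a, ∑ b, p a b * Real.log (r a) = -∑ a, Real.negMulLog (r a) := by
    simp only [← Finset.sum_mul, Real.negMulLog, ← Finset.sum_neg_distrib, neg_mul, neg_neg]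
    rfl
  have e2 : ∑ a, ∑ b, p a b * Real.log (c b) = -∑ b, Real.negMulLog (c b) := by
    rw [Finset.sum_comm]
    simp only [← Finset.sum_mul, Real.negMulLog, ← Finset.sum_neg_distrib, neg_mul, neg_neg]
    rfl
  have e3 : ∑ a, ∑ b, p a b * Real.log T = -Real.negMulLog T := by
    simp only [← Finset.sum_mul, Real.negMulLog, neg_mul, neg_neg]
    rfl
  have e4 : ∑ a, ∑ b, r a * c b / T = T := by
    simp only [← Finset.sum_div, ← Finset.mul_sum, ← Finset.sum_mul, hrT, hcT]
    exact mul_self_div_self T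
  simp only [Finset.sum_add_distrib, Finset.sum_sub_distrib, Finset.sum_neg_distrib, e1, e2, e3,
    e4] at hsum
  rw [← hT] at hsum
  linarith

section PartitionEntropy

variable {Ω : Type*} [MeasurableSpace Ω] {μ : Measure Ω} [IsFiniteMeasure μ]
variable {ι κ τ : Type*} [Fintype ι] [Fintype κ] [Fintype τ]
  [MeasurableSpace ι] [MeasurableSingletonClass ι] [MeasurableSpace κ] [MeasurableSingletonClass κ]
  [MeasurableSpace τ] [MeasurableSingletonClass τ]

lemma measureReal_preimage_comp {ι κ : Type*} [Fintype ι] [MeasurableSpace ι]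
    [MeasurableSingletonClass ι] [DecidableEq κ] {f : Ω → ι} (hf : Measurable f)
    (φ : ι → κ) (j : κ) :
    μ.real ((fun x => φ (f x)) ⁻¹' {j}) = ∑ i with φ i = j, μ.real (f ⁻¹' {i}) := by
  rw [sum_measureReal_preimage_singleton _ fun i _ => hf (measurableSet_singleton i)]
  congr 1
  ext x
  simp

lemma partitionEntropy_comp_le {ι κ : Type*} [Fintype ι] [Fintype κ] [MeasurableSpace ι]
    [MeasurableSingletonClass ι] {f : Ω → ι} (hf : Measurable f) (φ : ι → κ) :
    partitionEntropy μ (fun x => φ (f x)) ≤ partitionEntropy μ f := by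
  classical
  unfold partitionEntropy
  calc _ ≤ ∑ j, ∑ i with φ i = j, Real.negMulLog (μ.real (f ⁻¹' {i})) := by
        refine Finset.sum_le_sum fun j _ => ?_
        rw [measureReal_preimage_comp hf]
        exact negMulLog_sum_le _ _ fun i => measureReal_nonneg
    _ = _ := Finset.sum_fiberwise _ _ _

/-- Working form of monotonicity: comparing two joint entropies reduces to reconstructing one
observable from the other. -/
lemma partitionEntropy_le_of_factor {ι κ : Type*} [Fintype ι] [Fintype κ] [MeasurableSpace ι]
    [MeasurableSingletonClass ι] {f : Ω → ι} {g : Ω → κ}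
    (hf : Measurable f) (φ : ι → κ) (h : ∀ x, g x = φ (f x)) :
    partitionEntropy μ g ≤ partitionEntropy μ f := by
  rw [show g = fun x => φ (f x) from funext h]
  exact partitionEntropy_comp_le hf φ

lemma partitionEntropy_eq_of_factor {f : Ω → ι} {g : Ω → κ}
    (hf : Measurable f) (hg : Measurable g) (φ : ι → κ) (ψ : κ → ι) (h : ∀ x, g x = φ (f x))
    (h' : ∀ x, f x = ψ (g x)) :
    partitionEntropy μ g = partitionEntropy μ f :=
  le_antisymm (partitionEntropy_le_of_factor hf φ h) (partitionEntropy_le_of_factor hg ψ h')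

lemma partitionEntropy_comp_measurePreserving {T : Ω → Ω} (hT : MeasurePreserving T μ μ)
    {f : Ω → ι} (hf : Measurable f) :
    partitionEntropy μ (fun x => f (T x)) = partitionEntropy μ f := by
  unfold partitionEntropy
  refine Finset.sum_congr rfl fun i _ => ?_
  have := hT.measureReal_preimage (hf (measurableSet_singleton i)).nullMeasurableSet
  rw [← this]
  rfl

/-- Strong subadditivity of Shannon entropy. -/
lemma partitionEntropy_strong_subadditive {f : Ω → ι} {g : Ω → κ} {k : Ω → τ}
    (hf : Measurable f) (hg : Measurable g) (hk : Measurable k) :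
    partitionEntropy μ (fun x => (f x, g x, k x)) + partitionEntropy μ k ≤
      partitionEntropy μ (fun x => (f x, k x)) + partitionEntropy μ (fun x => (g x, k x)) := by
  classical
  set F : Ω → ι × κ × τ := fun x => (f x, g x, k x) with hF
  have hFm : Measurable F := hf.prodMk (hg.prodMk hk)
  set P : ι → κ → τ → ℝ := fun a b c => μ.real (F ⁻¹' {(a, b, c)}) with hP
  have h1 : ∀ c, μ.real (k ⁻¹' {c}) = ∑ a, ∑ b, P a b c := by
    intro c
    have := measureReal_preimage_comp (μ := μ) hFm (fun y => y.2.2) c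
    rw [Finset.sum_filter, Fintype.sum_prod_type] at this
    simpa [Fintype.sum_prod_type] using this
  have h2 : ∀ a c, μ.real ((fun x => (f x, k x)) ⁻¹' {(a, c)}) = ∑ b, P a b c := by
    intro a c
    have := measureReal_preimage_comp (μ := μ) hFm (fun y => (y.1, y.2.2)) (a, c)
    rw [Finset.sum_filter, Fintype.sum_prod_type] at this
    simpa [Fintype.sum_prod_type, Prod.mk.injEq, ite_and, Finset.sum_ite_irrel] using this
  have h3 : ∀ b c, μ.real ((fun x => (g x, k x)) ⁻¹' {(b, c)}) = ∑ a, P a b c := by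
    intro b c
    have := measureReal_preimage_comp (μ := μ) hFm (fun y => (y.2.1, y.2.2)) (b, c)
    rw [Finset.sum_filter, Fintype.sum_prod_type] at this
    simpa [Fintype.sum_prod_type, Prod.mk.injEq, ite_and, Finset.sum_ite_irrel] using this
  -- On each fibre `k = c` this is nonnegativity of mutual information for an unnormalized array;
  -- summing over `c` gives the conditional version.
  have h4 := Finset.sum_le_sum fun c (_ : c ∈ Finset.univ) =>
    sum_negMulLog_add_negMulLog_sum_le (fun a b => P a b c) fun a b => measureReal_nonneg
  simp only [Finset.sum_add_distrib] at h4
  unfold partitionEntropy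
  simp only [Fintype.sum_prod_type, h1, h2, h3]
  have e1 : ∑ c, ∑ a, ∑ b, Real.negMulLog (P a b c) = ∑ a, ∑ b, ∑ c, Real.negMulLog (P a b c) := by
    rw [Finset.sum_comm]
    exact Finset.sum_congr rfl fun a _ => Finset.sum_comm
  rw [e1, Finset.sum_comm (f := fun c a => Real.negMulLog (∑ b, P a b c)),
    Finset.sum_comm (f := fun c b => Real.negMulLog (∑ a, P a b c))] at h4
  exact h4

end PartitionEntropy

/-! ### The entropy of a shift is computed by the partition at time zero -/

section Conditional

variable {Ω : Type*} [MeasurableSpace Ω] {μ : Measure Ω} [IsFiniteMeasure μ]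
variable {ι κ : Type*} [Fintype ι] [Fintype κ]
  [MeasurableSpace ι] [MeasurableSingletonClass ι] [MeasurableSpace κ] [MeasurableSingletonClass κ]

lemma measurable_itinerary {T : Ω → Ω} (hT : Measurable T) {f : Ω → ι} (hf : Measurable f)
    (n : ℕ) : Measurable (itinerary T f n) :=
  measurable_pi_lambda _ fun i => hf.comp (hT.iterate i)

lemma itinerary_succ_castSucc (T : Ω → Ω) (f : Ω → ι) (n : ℕ) (x : Ω) :
    itinerary T f (n + 1) x = Fin.snoc (itinerary T f n x) (f (T^[n] x)) := by
  ext i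
  refine Fin.lastCases ?_ (fun i => ?_) i <;> simp [itinerary]

/-- The entropy of the joint itinerary exceeds that of the itinerary of `g` by at most `n` times
the conditional entropy of `f` given `g`. -/
lemma partitionEntropy_itinerary_prod_le {T : Ω → Ω} (hT : MeasurePreserving T μ μ) {f : Ω → ι}
    {g : Ω → κ} (hf : Measurable f) (hg : Measurable g) (n : ℕ) :
    partitionEntropy μ (itinerary T (fun x => (f x, g x)) n) ≤
      partitionEntropy μ (itinerary T g n) +
        n * (partitionEntropy μ (fun x => (f x, g x)) - partitionEntropy μ g) := by
  induction n with
  | zero =>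
    simpa using partitionEntropy_le_of_factor (measurable_itinerary hT.measurable hg 0)
      (fun _ => Fin.elim0) fun x => Subsingleton.elim _ _
  | succ n ih =>
    have hTn := hT.iterate n
    set X := itinerary T f n
    set Y : Ω → ι := fun x => f (T^[n] x)
    set G := itinerary T g n
    set y : Ω → κ := fun x => g (T^[n] x)
    set G' := itinerary T g (n + 1)
    have hX : Measurable X := measurable_itinerary hT.measurable hf n
    have hG : Measurable G := measurable_itinerary hT.measurable hg n
    have hG' : Measurable G' := measurable_itinerary hT.measurable hg (n + 1)
    have hY : Measurable Y := hf.comp hTn.measurable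
    have hy : Measurable y := hg.comp hTn.measurable
    -- Here `G'` amounts to `(G, y)`. `s1` reads `H(X,Y|G') ≤ H(X|G') + H(Y|G')`, `s2` reads
    -- `H(X|G') ≤ H(X|G)`, and `s3` reads `H(Y|G') ≤ H(Y|y)`, which is `H(f|g)` by invariance.
    have s1 := partitionEntropy_strong_subadditive (μ := μ) hX hY hG'
    have s2 := partitionEntropy_strong_subadditive (μ := μ) hX hy hG
    have s3 := partitionEntropy_strong_subadditive (μ := μ) hY hG hy
    have hG'_eq : ∀ x, G' x = Fin.snoc (G x) (y x) := itinerary_succ_castSucc T g n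
    have f1 : partitionEntropy μ (itinerary T (fun x => (f x, g x)) (n + 1)) ≤
        partitionEntropy μ (fun x => (X x, Y x, G' x)) := by
      refine partitionEntropy_le_of_factor (hX.prodMk (hY.prodMk hG'))
        (fun w i => ((Fin.snoc w.1 w.2.1 : Fin (n + 1) → ι) i, w.2.2 i)) fun x => ?_
      ext i
      · have := congrFun (itinerary_succ_castSucc T f n x) i
        exact this
      · rfl
    have f2 : partitionEntropy μ (fun x => (X x, G' x)) ≤
        partitionEntropy μ (fun x => (X x, y x, G x)) :=
      partitionEntropy_le_of_factor (hX.prodMk (hy.prodMk hG))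
        (fun w => (w.1, Fin.snoc w.2.2 w.2.1)) fun x => by simp [hG'_eq]
    have f3 : partitionEntropy μ (fun x => (Y x, G' x)) ≤
        partitionEntropy μ (fun x => (Y x, G x, y x)) :=
      partitionEntropy_le_of_factor (hY.prodMk (hG.prodMk hy))
        (fun w => (w.1, Fin.snoc w.2.1 w.2.2)) fun x => by simp [hG'_eq]
    have f4 : partitionEntropy μ (fun x => (y x, G x)) ≤ partitionEntropy μ G' :=
      partitionEntropy_le_of_factor hG' (fun w => (w (Fin.last n), fun i => w i.castSucc))
        fun x => by simp [hG'_eq]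
    have f5 : partitionEntropy μ (fun x => (G x, y x)) ≤ partitionEntropy μ G' :=
      partitionEntropy_le_of_factor hG' (fun w => (fun i => w i.castSucc, w (Fin.last n)))
        fun x => by simp [hG'_eq]
    have f6 : partitionEntropy μ (fun x => (X x, G x)) ≤
        partitionEntropy μ (itinerary T (fun x => (f x, g x)) n) :=
      partitionEntropy_le_of_factor (measurable_itinerary hT.measurable (hf.prodMk hg) n)
        (fun w => (fun i => (w i).1, fun i => (w i).2)) fun x => rfl
    have f7 : partitionEntropy μ (fun x => (Y x, y x)) =
        partitionEntropy μ (fun x => (f x, g x)) :=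
      partitionEntropy_comp_measurePreserving hTn (f := fun x => (f x, g x)) (hf.prodMk hg)
    have f8 : partitionEntropy μ y = partitionEntropy μ g :=
      partitionEntropy_comp_measurePreserving hTn hg
    push_cast
    linarith

lemma partitionEntropy_itinerary_le {T : Ω → Ω} (hT : MeasurePreserving T μ μ) {f : Ω → ι}
    {g : Ω → κ} (hf : Measurable f) (hg : Measurable g) (n : ℕ) :
    partitionEntropy μ (itinerary T f n) ≤
      partitionEntropy μ (itinerary T g n) +
        n * (partitionEntropy μ (fun x => (f x, g x)) - partitionEntropy μ g) :=
  (partitionEntropy_le_of_factor (measurable_itinerary hT.measurable (hf.prodMk hg) n)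
    (fun w i => (w i).1) fun _ => rfl).trans (partitionEntropy_itinerary_prod_le hT hf hg n)

/-- Corresponding atoms of `h j` and `h'` differ only inside `{h j ≠ h'}`, and entropy is a finite
sum of continuous functions of the atom masses. -/
lemma tendsto_partitionEntropy {h : ℕ → Ω → ι} {h' : Ω → ι} (hm : ∀ j, Measurable (h j))
    (hm' : Measurable h') (hlim : Tendsto (fun j => μ.real {x | h j x ≠ h' x}) atTop (nhds 0)) :
    Tendsto (fun j => partitionEntropy μ (h j)) atTop (nhds (partitionEntropy μ h')) := by
  refine tendsto_finsetSum _ fun i _ => (Real.continuous_negMulLog.tendsto _).comp ?_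
  rw [tendsto_iff_dist_tendsto_zero]
  refine squeeze_zero (fun _ => dist_nonneg) (fun j => ?_) hlim
  rw [Real.dist_eq]
  refine (abs_measureReal_sub_le_measureReal_symmDiff
    (hm j (measurableSet_singleton i)).nullMeasurableSet
    (hm' (measurableSet_singleton i)).nullMeasurableSet).trans (measureReal_mono ?_)
  rintro x (⟨h1, h2⟩ | ⟨h1, h2⟩) h3
  · exact h2 (h3.symm.trans h1)
  · exact h2 (h3.trans h1)

end Conditional

/-! ### Words, finite windows and cylinder approximation. -/

section Shift

variable {S : Type*} [Fintype S] [MeasurableSpace S] [MeasurableSingletonClass S]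

/-- The word of length `n` read off a two-sided sequence from position `a` on. -/
def block {S : Type*} (a : ℤ) (n : ℕ) (x : ℤ → S) : Fin n → S := fun i => x (a + (i : ℕ))

lemma measurable_block (a : ℤ) (n : ℕ) : Measurable (block (S := S) a n) :=
  measurable_pi_lambda _ fun _ => measurable_pi_apply _

lemma shift_iterate_apply {S : Type*} (x : ℤ → S) (n : ℕ) (k : ℤ) :
    (shift^[n] x) k = x (k + n) := by
  induction n generalizing x with
  | zero => simp
  | succ n ih =>
    rw [Function.iterate_succ_apply, ih, shift]
    congr 1
    push_cast
    ring

lemma block_shift {S : Type*} (a : ℤ) (n : ℕ) (x : ℤ → S) :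
    block a n (shift x) = block (a + 1) n x := by
  ext i
  simp only [block, shift]
  congr 1
  ring

lemma itinerary_shift_eq_block {S : Type*} (n : ℕ) :
    itinerary shift (fun x : ℤ → S => x 0) n = block 0 n := by
  ext x i
  simp [itinerary, block, shift_iterate_apply]

lemma map_block_eq {μ : Measure (ℤ → S)} (hμ : MeasurePreserving shift μ μ) (a : ℤ) (n : ℕ) :
    μ.map (block a n) = μ.map (block 0 n) := by
  have step : ∀ b : ℤ, μ.map (block (b + 1) n) = μ.map (block b n) := fun b => by
    conv_rhs => rw [← hμ.map_eq, Measure.map_map (measurable_block b n) hμ.measurable]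
    congr 1
    ext x : 1
    exact (block_shift b n x).symm
  induction a using Int.induction_on with
  | zero => rfl
  | succ i ih => rw [step, ih]
  | pred i ih => rw [← ih, ← step, sub_add_cancel]

lemma partitionEntropy_eq_of_map_eq {Ω ι : Type*} [MeasurableSpace Ω] [Fintype ι]
    [MeasurableSpace ι] [MeasurableSingletonClass ι] {μ : Measure Ω} {f g : Ω → ι}
    (hf : Measurable f) (hg : Measurable g) (h : μ.map f = μ.map g) :
    partitionEntropy μ f = partitionEntropy μ g := by
  refine Finset.sum_congr rfl fun i _ => ?_
  rw [← map_measureReal_apply hf (measurableSet_singleton i), h,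
    map_measureReal_apply hg (measurableSet_singleton i)]

lemma partitionEntropy_block_eq {μ : Measure (ℤ → S)}
    (hμ : MeasurePreserving shift μ μ) (a : ℤ) (n : ℕ) :
    partitionEntropy μ (block a n) = partitionEntropy μ (block 0 n) :=
  partitionEntropy_eq_of_map_eq (measurable_block a n) (measurable_block 0 n) (map_block_eq hμ a n)

/-- `g` depends only on the coordinates in `[-m, m]`. -/
def DependsOnWindow {S κ : Type*} (g : (ℤ → S) → κ) (m : ℕ) : Prop :=
  ∀ x y, (∀ k : ℤ, |k| ≤ m → x k = y k) → g x = g y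

lemma exists_dependsOnWindow_of_mem_measurableCylinders {A : Set (ℤ → S)}
    (hA : A ∈ measurableCylinders fun _ : ℤ => S) : ∃ m, DependsOnWindow (· ∈ A) m := by
  obtain ⟨s, B, -, rfl⟩ := (mem_measurableCylinders A).1 hA
  refine ⟨s.sup Int.natAbs, fun x y hxy => ?_⟩
  have : s.restrict x = s.restrict y := by
    ext ⟨k, hk⟩
    refine hxy k ?_
    have := Finset.le_sup (f := Int.natAbs) hk
    rw [Int.abs_eq_natAbs]
    exact_mod_cast this
  simp [mem_cylinder, this]

lemma DependsOnWindow.mono {κ : Type*} {g : (ℤ → S) → κ} {m m' : ℕ} (h : DependsOnWindow g m)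
    (hm : m ≤ m') : DependsOnWindow g m' := fun x y hxy =>
  h x y fun k hk => hxy k (hk.trans (by exact_mod_cast hm))

/-- The first `n` values of `g` along an orbit see only the coordinates from `-m` to `n + m - 1`,
all of which lie in the block. -/
lemma partitionEntropy_itinerary_le_block {κ : Type*} [Fintype κ] {μ : Measure (ℤ → S)}
    [IsProbabilityMeasure μ] {g : (ℤ → S) → κ} {m : ℕ} (hg : DependsOnWindow g m) (n : ℕ) :
    partitionEntropy μ (itinerary shift g n) ≤
      partitionEntropy μ (block (S := S) (-m) (n + (2 * m + 1))) := by
  obtain ⟨x₀⟩ := nonempty_of_isProbabilityMeasure μ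
  have hfac : Function.FactorsThrough (itinerary shift g n)
      (block (S := S) (-m) (n + (2 * m + 1))) := by
    intro x y hxy
    ext i
    refine hg _ _ fun k hk => ?_
    rw [shift_iterate_apply, shift_iterate_apply]
    have hk' := abs_le.1 hk
    have hi := i.2
    have := congrFun hxy ⟨(k + m + i).toNat, by omega⟩
    simp only [block] at this
    convert this using 2 <;> omega
  exact partitionEntropy_le_of_factor (measurable_block _ _)
    (Function.extend (block (S := S) (-m) (n + (2 * m + 1))) (itinerary shift g n)
      fun _ => itinerary shift g n x₀) fun x => (hfac.extend_apply _ x).symm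

/-- Every finite measurable partition is approximated, in conditional entropy, by partitions
depending on finitely many coordinates. -/
lemma exists_dependsOnWindow_conditional_lt {μ : Measure (ℤ → S)} [IsProbabilityMeasure μ]
    {ι : Type} [Fintype ι] [DecidableEq ι] [MeasurableSpace ι] [MeasurableSingletonClass ι]
    {f : (ℤ → S) → ι} (hf : Measurable f) {ε : ℝ} (hε : 0 < ε) :
    ∃ (m : ℕ) (g : (ℤ → S) → (ι → Bool)), Measurable g ∧ DependsOnWindow g m ∧
      partitionEntropy μ (fun x => (f x, g x)) - partitionEntropy μ g < ε := by
  classical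
  obtain ⟨x₀⟩ := nonempty_of_isProbabilityMeasure μ
  have : Nonempty ι := ⟨f x₀⟩
  have hdense : μ.MeasureDense (measurableCylinders fun _ : ℤ => S) :=
    Measure.MeasureDense.of_generateFrom_isSetAlgebra_finite _ isSetAlgebra_measurableCylinders
      generateFrom_measurableCylinders.symm
  have happ : ∀ (j : ℕ) (i : ι), ∃ A ∈ measurableCylinders fun _ : ℤ => S,
      μ (symmDiff (f ⁻¹' {i}) A) < ENNReal.ofReal (1 / ((j : ℝ) + 1)) := fun j i =>
    hdense.approx _ (hf (measurableSet_singleton i)) (measure_ne_top _ _) _ (by positivity)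
  choose A hA hAlt using happ
  have hAm : ∀ j i, MeasurableSet (A j i) := fun j i => .of_mem_measurableCylinders (hA j i)
  -- The approximating cylinders need be neither disjoint nor covering, so all membership bits are
  -- recorded; `ind` is the same encoding for the exact atoms of `f`.
  set g : ℕ → (ℤ → S) → (ι → Bool) := fun j x i => decide (x ∈ A j i) with hg
  have hgm : ∀ j, Measurable (g j) := fun j =>
    measurable_pi_lambda _ fun i => measurable_to_bool (by
      convert hAm j i using 1
      ext x; simp [hg])
  set ind : ι → (ι → Bool) := fun a i => decide (a = i) with hind
  have hind_inj : Function.Injective ind := fun a b hab => by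
    have := congrFun hab b
    simpa [hind] using this
  have hindm : Measurable fun x => ind (f x) := (measurable_of_finite ind).comp hf
  have hlim : Tendsto (fun j => μ.real {x | g j x ≠ ind (f x)}) atTop (nhds 0) := by
    have h0 : Tendsto (fun j : ℕ => (Fintype.card ι : ℝ) * (1 / ((j : ℝ) + 1))) atTop (nhds 0) := by
      simpa using tendsto_one_div_add_atTop_nhds_zero_nat.const_mul (Fintype.card ι : ℝ)
    refine squeeze_zero (fun _ => measureReal_nonneg) (fun j => ?_) h0
    calc μ.real {x | g j x ≠ ind (f x)} ≤ μ.real (⋃ i : ι, symmDiff (f ⁻¹' {i}) (A j i)) := by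
          refine measureReal_mono fun x hx => ?_
          obtain ⟨i, hi⟩ := Function.ne_iff.1 hx
          refine Set.mem_iUnion.2 ⟨i, ?_⟩
          simp only [hg, hind, ne_eq, decide_eq_decide] at hi
          simp only [Set.mem_symmDiff, Set.mem_preimage, Set.mem_singleton_iff]
          tauto
      _ ≤ ∑ i : ι, μ.real (symmDiff (f ⁻¹' {i}) (A j i)) := measureReal_iUnion_fintype_le _
      _ ≤ ∑ _i : ι, 1 / ((j : ℝ) + 1) := by
          refine Finset.sum_le_sum fun i _ => ?_
          exact ENNReal.toReal_le_of_le_ofReal (by positivity) (hAlt j i).le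
      _ = _ := by simp
  have h1 := tendsto_partitionEntropy hgm hindm hlim
  have h2 := tendsto_partitionEntropy (μ := μ) (h := fun j x => (f x, g j x))
    (h' := fun x => (f x, ind (f x))) (fun j => hf.prodMk (hgm j)) (hf.prodMk hindm)
    (by simpa using hlim)
  -- Since `ind` is injective, `f` is a function of `ind ∘ f`, so the limiting conditional entropy
  -- is at most zero.
  have h3 : partitionEntropy μ (fun x => (f x, ind (f x))) ≤
      partitionEntropy μ fun x => ind (f x) :=
    partitionEntropy_le_of_factor hindm (fun b => (Function.invFun ind b, b)) fun x => by
      rw [Function.leftInverse_invFun hind_inj]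
  have h4 := h2.sub h1
  obtain ⟨j, hj⟩ := (h4.eventually (gt_mem_nhds (by linarith : _ < ε))).exists
  choose m hm using fun i => exists_dependsOnWindow_of_mem_measurableCylinders (hA j i)
  refine ⟨Finset.univ.sup m, g j, hgm j, fun x y hxy => ?_, hj⟩
  ext i
  have := (hm i).mono (Finset.le_sup (Finset.mem_univ i)) x y hxy
  exact decide_eq_decide.2 (iff_of_eq this)

/-- A linear bound on the entropy of words bounds the Kolmogorov--Sinai entropy of the shift. -/
theorem measureEntropy_shift_le {μ : Measure (ℤ → S)} [IsProbabilityMeasure μ]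
    (hμ : MeasurePreserving shift μ μ) {a C : ℝ}
    (h : ∀ n : ℕ, partitionEntropy μ (block (S := S) 0 n) ≤ a * n + C) :
    measureEntropy μ shift ≤ (a : EReal) := by
  refine iSup_le fun k => iSup_le fun f => iSup_le fun hf => ?_
  rw [← EReal.le_of_forall_lt_iff_le]
  intro z hz
  have hz' : a < z := by exact_mod_cast hz
  -- The slack `z - a` absorbs the conditional entropy of `f` given a window partition.
  obtain ⟨m, g, hgm, hgw, hlt⟩ :=
    exists_dependsOnWindow_conditional_lt (μ := μ) hf (sub_pos.2 hz')
  have hbound : ∀ n : ℕ, 0 < n → partitionEntropy μ (itinerary shift f n) / n ≤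
      z + (a * (2 * m + 1) + C) / n := by
    intro n hn
    have hn' : (0 : ℝ) < n := by exact_mod_cast hn
    have h1 := partitionEntropy_itinerary_le hμ hf hgm n
    have h2 := partitionEntropy_itinerary_le_block (μ := μ) hgw n
    rw [partitionEntropy_block_eq hμ] at h2
    have h3 := h (n + (2 * m + 1))
    push_cast at h3
    have h4 := mul_le_mul_of_nonneg_left hlt.le hn'.le
    rw [div_le_iff₀ hn', add_mul, div_mul_cancel₀ _ hn'.ne']
    nlinarith
  have hlim : Tendsto (fun n : ℕ => ((z + (a * (2 * m + 1) + C) / n : ℝ) : EReal)) atTop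
      (nhds (z : EReal)) := by
    refine (continuous_coe_real_ereal.tendsto z).comp ?_
    simpa using (tendsto_const_div_atTop_nhds_zero_nat (a * (2 * m + 1) + C)).const_add z
  refine (limsup_le_limsup ?_).trans hlim.limsup_eq.le
  filter_upwards [eventually_gt_atTop 0] with n hn
  exact_mod_cast hbound n hn

end Shift

/-! ### Two-sided stationary Markov measures -/

section Blocks

variable {S : Type*} [Fintype S] [MeasurableSpace S] [MeasurableSingletonClass S]

lemma measureReal_eq_sum_inter {Ω : Type*} [MeasurableSpace Ω] (μ : Measure Ω) [IsFiniteMeasure μ]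
    {f : Ω → S} (hf : Measurable f) (A : Set Ω) :
    μ.real A = ∑ s, μ.real (A ∩ f ⁻¹' {s}) := by
  have := sum_measureReal_preimage_singleton (μ := μ.restrict A) Finset.univ (f := f)
    fun y _ => hf (measurableSet_singleton y)
  rw [Finset.coe_univ, Set.preimage_univ, measureReal_restrict_apply MeasurableSet.univ,
    Set.univ_inter] at this
  rw [← this]
  refine Finset.sum_congr rfl fun s _ => ?_
  rw [measureReal_restrict_apply (hf (measurableSet_singleton s)), Set.inter_comm]

lemma block_eq_snoc {S : Type*} (a : ℤ) (n : ℕ) (x : ℤ → S) :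
    block a (n + 1) x = Fin.snoc (block a n x) (x (a + n)) := by
  ext i
  refine Fin.lastCases ?_ (fun i => ?_) i <;> simp [block]

lemma block_eq_cons {S : Type*} (a : ℤ) (n : ℕ) (x : ℤ → S) :
    block a (n + 1) x = Fin.cons (x a) (block (a + 1) n x) := by
  ext i
  refine Fin.cases ?_ (fun i => ?_) i
  · simp [block]
  · simp only [block, Fin.val_succ, Fin.cons_succ]
    congr 1
    push_cast
    ring

lemma preimage_block_snoc {S : Type*} (a : ℤ) (n : ℕ) (w : Fin n → S) (t : S) :
    block a (n + 1) ⁻¹' {Fin.snoc w t} =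
      block a n ⁻¹' {w} ∩ (fun x : ℤ → S => x (a + n)) ⁻¹' {t} := by
  ext x
  simp [block_eq_snoc, Fin.snoc_inj]

lemma preimage_block_cons {S : Type*} (a : ℤ) (n : ℕ) (w : Fin n → S) (t : S) :
    block a (n + 1) ⁻¹' {Fin.cons t w} =
      block (a + 1) n ⁻¹' {w} ∩ (fun x : ℤ → S => x a) ⁻¹' {t} := by
  ext x
  simp [block_eq_cons, Fin.cons_inj, and_comm]

lemma measurableSet_preimage_block (a : ℤ) (n : ℕ) (w : Fin n → S) :
    MeasurableSet (block a n ⁻¹' {w}) :=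
  measurable_block a n (measurableSet_singleton w)

lemma sum_measureReal_block_snoc (μ : Measure (ℤ → S)) [IsFiniteMeasure μ] (a : ℤ) (n : ℕ)
    (w : Fin n → S) :
    ∑ t, μ.real (block a (n + 1) ⁻¹' {Fin.snoc w t}) = μ.real (block a n ⁻¹' {w}) := by
  rw [measureReal_eq_sum_inter μ (measurable_pi_apply (a + n))]
  exact Finset.sum_congr rfl fun t _ => by rw [preimage_block_snoc]

lemma sum_measureReal_block_cons (μ : Measure (ℤ → S)) [IsFiniteMeasure μ] (a : ℤ) (n : ℕ)
    (w : Fin n → S) :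
    ∑ t, μ.real (block a (n + 1) ⁻¹' {Fin.cons t w}) = μ.real (block (a + 1) n ⁻¹' {w}) := by
  rw [measureReal_eq_sum_inter μ (measurable_pi_apply a)]
  exact Finset.sum_congr rfl fun t _ => by rw [preimage_block_cons]

/-- A probability measure on two-sided sequences is determined by the laws of its blocks. -/
lemma eq_of_measureReal_block_eq {μ ν : Measure (ℤ → S)} [IsProbabilityMeasure μ]
    [IsProbabilityMeasure ν]
    (h : ∀ (a : ℤ) (n : ℕ) (w : Fin (n + 1) → S),
      μ.real (block a (n + 1) ⁻¹' {w}) = ν.real (block a (n + 1) ⁻¹' {w})) : μ = ν := by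
  refine ext_of_generate_finite _ generateFrom_measurableCylinders.symm isPiSystem_measurableCylinders
    (fun A hA => ?_) (by simp)
  obtain ⟨m, hm⟩ := exists_dependsOnWindow_of_mem_measurableCylinders hA
  have hmap : μ.map (block (-(m : ℤ)) (2 * m + 1)) = ν.map (block (-(m : ℤ)) (2 * m + 1)) := by
    refine Measure.ext_of_singleton fun w => ?_
    rw [Measure.map_apply (measurable_block _ _) (measurableSet_singleton w),
      Measure.map_apply (measurable_block _ _) (measurableSet_singleton w),
      ← ENNReal.toReal_eq_toReal_iff' (measure_ne_top _ _) (measure_ne_top _ _)]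
    exact h _ _ w
  have hA' : A = block (-(m : ℤ)) (2 * m + 1) ⁻¹' (block (-(m : ℤ)) (2 * m + 1) '' A) := by
    refine (Set.subset_preimage_image _ _).antisymm ?_
    rintro x ⟨y, hy, hyx⟩
    refine (iff_of_eq (hm x y fun k hk => ?_)).2 hy
    have hk' := abs_le.1 hk
    have := congrFun hyx ⟨(k + m).toNat, by omega⟩
    simp only [block] at this
    rw [show (-(m : ℤ) + ((k + m).toNat : ℕ)) = k by omega] at this
    exact this.symm
  have hB : MeasurableSet (block (-(m : ℤ)) (2 * m + 1) '' A) := (Set.toFinite _).measurableSet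
  rw [hA', ← Measure.map_apply (measurable_block _ _) hB, hmap,
    Measure.map_apply (measurable_block _ _) hB]

end Blocks

/-! ### Word weights of a Markov chain and their two-sided extension. -/

section Markov

variable {S : Type*} [Fintype S]

/-- The probability of a word under the Markov chain with initial law `π` and transition
probabilities `p`. -/
def markovWeight (π : S → ℝ) (p : S → S → ℝ) {n : ℕ} (w : Fin (n + 1) → S) : ℝ :=
  π (w 0) * ∏ i : Fin n, p (w i.castSucc) (w i.succ)

lemma markovWeight_snoc (π : S → ℝ) (p : S → S → ℝ) {n : ℕ} (w : Fin (n + 1) → S) (t : S) :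
    markovWeight π p (Fin.snoc w t : Fin (n + 2) → S) = markovWeight π p w * p (w (Fin.last n)) t := by
  rw [markovWeight, markovWeight, Fin.prod_univ_castSucc, ← mul_assoc]
  congr 1
  · congr 1
    refine Finset.prod_congr rfl fun i _ => ?_
    rw [Fin.snoc_castSucc, ← Fin.castSucc_succ, Fin.snoc_castSucc]
  · rw [Fin.snoc_castSucc, Fin.succ_last, Fin.snoc_last]

lemma markovWeight_cons (π : S → ℝ) (p : S → S → ℝ) {n : ℕ} (w : Fin (n + 1) → S) (s : S) :
    markovWeight π p (Fin.cons s w : Fin (n + 2) → S) =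
      π s * p s (w 0) * ∏ i : Fin n, p (w i.castSucc) (w i.succ) := by
  rw [markovWeight, Fin.prod_univ_succ, ← mul_assoc]
  congr 1

/-- `π` is a stationary law of the Markov chain with transition probabilities `p`. -/
structure IsStationaryChain (π : S → ℝ) (p : S → S → ℝ) : Prop where
  nonneg : ∀ s, 0 ≤ π s
  transition_nonneg : ∀ s t, 0 ≤ p s t
  sum_eq_one : ∑ s, π s = 1
  sum_transition : ∀ s, ∑ t, p s t = 1
  stationary : ∀ t, ∑ s, π s * p s t = π t

variable {π : S → ℝ} {p : S → S → ℝ}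

lemma IsStationaryChain.markovWeight_nonneg (h : IsStationaryChain π p) {n : ℕ}
    (w : Fin (n + 1) → S) : 0 ≤ markovWeight π p w :=
  mul_nonneg (h.nonneg _) (Finset.prod_nonneg fun _ _ => h.transition_nonneg _ _)

lemma IsStationaryChain.sum_markovWeight_snoc (h : IsStationaryChain π p) {n : ℕ}
    (w : Fin (n + 1) → S) :
    ∑ t, markovWeight π p (Fin.snoc w t : Fin (n + 2) → S) = markovWeight π p w := by
  simp [markovWeight_snoc, ← Finset.mul_sum, h.sum_transition]

lemma IsStationaryChain.sum_markovWeight_cons (h : IsStationaryChain π p) {n : ℕ}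
    (w : Fin (n + 1) → S) :
    ∑ t, markovWeight π p (Fin.cons t w : Fin (n + 2) → S) = markovWeight π p w := by
  simp only [markovWeight_cons, ← Finset.sum_mul, h.stationary]
  rfl

lemma IsStationaryChain.sum_markovWeight (h : IsStationaryChain π p) (n : ℕ) :
    ∑ w : Fin (n + 1) → S, markovWeight π p w = 1 := by
  induction n with
  | zero =>
    rw [← h.sum_eq_one]
    exact Fintype.sum_equiv (Equiv.funUnique (Fin 1) S) _ _ fun w => by simp [markovWeight]
  | succ n ih =>
    rw [← ih, ← (Fin.snocEquiv fun _ : Fin (n + 2) => S).sum_comp, Fintype.sum_prod_type_right]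
    exact Finset.sum_congr rfl fun w _ => h.sum_markovWeight_snoc w

variable [MeasurableSpace S] [MeasurableSingletonClass S]

/-- The block of length `n + 1` at position `a` has the law prescribed by the Markov chain. -/
def HasMarkovBlock (π : S → ℝ) (p : S → S → ℝ) (μ : Measure (ℤ → S)) (a : ℤ) (n : ℕ) : Prop :=
  ∀ w : Fin (n + 1) → S, μ.real (block a (n + 1) ⁻¹' {w}) = markovWeight π p w

lemma HasMarkovBlock.init (h : IsStationaryChain π p) {μ : Measure (ℤ → S)} [IsFiniteMeasure μ]
    {a : ℤ} {n : ℕ} (hμ : HasMarkovBlock π p μ a (n + 1)) : HasMarkovBlock π p μ a n := fun w => by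
  rw [← sum_measureReal_block_snoc, ← h.sum_markovWeight_snoc]
  exact Finset.sum_congr rfl fun t _ => hμ _

lemma HasMarkovBlock.tail (h : IsStationaryChain π p) {μ : Measure (ℤ → S)} [IsFiniteMeasure μ]
    {a : ℤ} {n : ℕ} (hμ : HasMarkovBlock π p μ a (n + 1)) : HasMarkovBlock π p μ (a + 1) n :=
  fun w => by
  rw [← sum_measureReal_block_cons, ← h.sum_markovWeight_cons]
  exact Finset.sum_congr rfl fun t _ => hμ _

/-- Trimming a word on the right uses that transition rows sum to one; trimming on the left uses
stationarity. -/
lemma HasMarkovBlock.of_le (h : IsStationaryChain π p) {μ : Measure (ℤ → S)} [IsFiniteMeasure μ]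
    {a b : ℤ} {m n : ℕ} (hμ : HasMarkovBlock π p μ a m) (hab : a ≤ b) (hmn : b + n ≤ a + m) :
    HasMarkovBlock π p μ b n := by
  have h1 : ∀ (k j : ℕ) (c : ℤ), HasMarkovBlock π p μ c (j + k) → HasMarkovBlock π p μ c j := by
    intro k
    induction k with
    | zero => exact fun _ _ h => h
    | succ k ih => exact fun j c hc => ih j c (hc.init h)
  have h2 : ∀ (k j : ℕ) (c : ℤ), HasMarkovBlock π p μ c (j + k) →
      HasMarkovBlock π p μ (c + k) j := by
    intro k
    induction k with
    | zero => exact fun _ _ h => by simpa using h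
    | succ k ih =>
      intro j c hc
      have := ih j (c + 1) (HasMarkovBlock.tail h hc)
      rwa [show c + ((k + 1 : ℕ) : ℤ) = c + 1 + k by push_cast; ring]
  obtain ⟨k, rfl⟩ := Int.le.dest hab
  obtain ⟨j, rfl⟩ : ∃ j, m = n + k + j := ⟨m - (n + k), by omega⟩
  exact h2 k n a (h1 j _ _ hμ)

/-- Only one block is prescribed, so a finite combination of Dirac masses suffices; the values of
`ext w` outside the block are arbitrary. -/
lemma exists_hasMarkovBlock (h : IsStationaryChain π p) (a : ℤ) (n : ℕ) :
    ∃ μ : Measure (ℤ → S), IsProbabilityMeasure μ ∧ HasMarkovBlock π p μ a n := by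
  classical
  set ext : (Fin (n + 1) → S) → ℤ → S := fun w k => w (Fin.ofNat (n + 1) (k - a).toNat) with hext
  have hblock : ∀ w, block a (n + 1) (ext w) = w := fun w => by
    ext i
    simp [block, hext]
  set μ : Measure (ℤ → S) := ∑ w : Fin (n + 1) → S,
    ENNReal.ofReal (markovWeight π p w) • Measure.dirac (ext w) with hμ
  have hval : ∀ A : Set (ℤ → S), MeasurableSet A →
      μ A = ∑ w with ext w ∈ A, ENNReal.ofReal (markovWeight π p w) := by
    intro A hA
    simp [hμ, Measure.finsetSum_apply, Measure.dirac_apply' _ hA, Finset.sum_filter,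
      Set.indicator_apply]
  refine ⟨μ, ⟨?_⟩, fun w => ?_⟩
  · rw [hval _ MeasurableSet.univ]
    simp only [Set.mem_univ, Finset.filter_true]
    rw [← ENNReal.ofReal_sum_of_nonneg fun w _ => h.markovWeight_nonneg w, h.sum_markovWeight,
      ENNReal.ofReal_one]
  · rw [measureReal_def, hval _ (measurableSet_preimage_block a _ w)]
    simp [hblock, Finset.filter_eq', ENNReal.toReal_ofReal (h.markovWeight_nonneg w)]

/-- Kolmogorov extension for stationary Markov chains with finitely many states. -/
theorem IsStationaryChain.exists_measure (h : IsStationaryChain π p) :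
    ∃ μ : Measure (ℤ → S), IsProbabilityMeasure μ ∧ ∀ a n, HasMarkovBlock π p μ a n := by
  -- The extension is obtained by compactness: for `S` finite and discrete, the probability measures
  -- on `ℤ → S` form a compact space in which the `C m` are nonempty, nested and closed.
  let _ : TopologicalSpace S := ⊥
  have : DiscreteTopology S := ⟨rfl⟩
  set C : ℕ → Set (ProbabilityMeasure (ℤ → S)) := fun m =>
    {μ | HasMarkovBlock π p (μ : Measure (ℤ → S)) (-m) (2 * m)} with hC
  have hclosed : ∀ m, IsClosed (C m) := by
    intro m
    have : C m = ⋂ w : Fin (2 * m + 1) → S,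
        {μ : ProbabilityMeasure (ℤ → S) | (μ : Measure (ℤ → S)).real (block (-(m : ℤ)) (2 * m + 1) ⁻¹' {w}) =
          markovWeight π p w} := by
      ext μ
      simp [hC, HasMarkovBlock]
    rw [this]
    refine isClosed_iInter fun w => ?_
    refine isClosed_eq ?_ continuous_const
    -- The mass of a clopen set is continuous under weak convergence.
    have hclopen : IsClopen (block (S := S) (-(m : ℤ)) (2 * m + 1) ⁻¹' {w}) :=
      (isClopen_discrete {w}).preimage (continuous_pi fun i => continuous_apply _)
    rw [continuous_iff_continuousAt]
    intro μ
    have := ProbabilityMeasure.tendsto_measure_of_isClopen_of_tendsto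
      (μs := fun ν : ProbabilityMeasure (ℤ → S) => ν) (L := nhds μ) tendsto_id hclopen
    exact (NNReal.continuous_coe.tendsto _).comp this
  obtain ⟨μ, hμ⟩ := IsCompact.nonempty_iInter_of_sequence_nonempty_isCompact_isClosed C
    (fun m μ hμ => hμ.of_le h (by push_cast; omega) (by push_cast; omega))
    (fun m => by
      obtain ⟨μ, hμ, hb⟩ := exists_hasMarkovBlock h (-(m : ℤ)) (2 * m)
      exact ⟨⟨μ, hμ⟩, hb⟩)
    (hclosed 0).isCompact hclosed
  refine ⟨μ, inferInstance, fun a n => ?_⟩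
  have := Set.mem_iInter.1 hμ (a.natAbs + n)
  exact HasMarkovBlock.of_le h this (by push_cast; grind) (by push_cast; grind)

end Markov

/-! ### Increments of the entropy of words -/

/-- The increments decrease, so on both sides of `k` the sequence stays below the line through its
values at `k` and `k + 1`. -/
lemma le_add_mul_of_concave {u : ℕ → ℝ} (hu : ∀ n, u (n + 2) + u n ≤ 2 * u (n + 1)) (k n : ℕ) :
    u n ≤ u k + ((n : ℝ) - k) * (u (k + 1) - u k) := by
  have hd : Antitone fun n => u (n + 1) - u n := antitone_nat_of_succ_le fun n => by
    have := hu n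
    show u (n + 1 + 1) - u (n + 1) ≤ u (n + 1) - u n
    linarith
  rcases le_total k n with h | h
  · obtain ⟨j, rfl⟩ := Nat.exists_eq_add_of_le h
    clear h
    induction j with
    | zero => simp
    | succ j ih =>
      have := hd (show k ≤ k + j by omega)
      simp only at this
      push_cast at ih ⊢
      rw [← add_assoc]
      nlinarith
  · obtain ⟨j, rfl⟩ := Nat.exists_eq_add_of_le h
    clear h
    induction j with
    | zero => simp
    | succ j ih =>
      have := hd (show n + j ≤ n + j + 1 by omega)
      simp only at this
      push_cast at ih ⊢
      rw [← add_assoc]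
      have hj : (0 : ℝ) ≤ j := j.cast_nonneg
      nlinarith

section Increments

variable {S : Type*} [Fintype S] [MeasurableSpace S] [MeasurableSingletonClass S]
  {μ : Measure (ℤ → S)} [IsProbabilityMeasure μ]

/-- Strong subadditivity for the first and the last letter given the word between them. -/
lemma partitionEntropy_block_concave (hμ : MeasurePreserving shift μ μ) (n : ℕ) :
    partitionEntropy μ (block (S := S) 0 (n + 2)) + partitionEntropy μ (block (S := S) 0 n) ≤
      2 * partitionEntropy μ (block (S := S) 0 (n + 1)) := by
  set X : (ℤ → S) → S := fun x => x 0
  set Y : (ℤ → S) → S := fun x => x (1 + n)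
  set Z := block (S := S) 1 n
  have hX : Measurable X := measurable_pi_apply 0
  have hY : Measurable Y := measurable_pi_apply _
  have hZ : Measurable Z := measurable_block 1 n
  have s := partitionEntropy_strong_subadditive (μ := μ) hX hY hZ
  have f1 : partitionEntropy μ (block (S := S) 0 (n + 2)) ≤
      partitionEntropy μ (fun x => (X x, Y x, Z x)) :=
    partitionEntropy_le_of_factor (hX.prodMk (hY.prodMk hZ))
      (fun w => Fin.cons w.1 (Fin.snoc w.2.2 w.2.1 : Fin (n + 1) → S)) fun x => by
        rw [block_eq_cons, block_eq_snoc]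
        rfl
  have f2 : partitionEntropy μ (fun x => (X x, Z x)) ≤
      partitionEntropy μ (block (S := S) 0 (n + 1)) :=
    partitionEntropy_le_of_factor (measurable_block _ _)
      (fun w => (w 0, fun i => w i.succ)) fun x => by
        rw [block_eq_cons]
        rfl
  have f3 : partitionEntropy μ (fun x => (Y x, Z x)) ≤
      partitionEntropy μ (block (S := S) 1 (n + 1)) :=
    partitionEntropy_le_of_factor (measurable_block _ _)
      (fun w => (w (Fin.last n), fun i => w i.castSucc)) fun x => by
        rw [block_eq_snoc]
        simp [Y, Z]
  rw [partitionEntropy_block_eq hμ] at f3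
  have f4 : partitionEntropy μ Z = _ := partitionEntropy_block_eq hμ 1 n
  linarith

/-- The entropy of a shift is at most the entropy increment of its words. -/
lemma measureEntropy_shift_le_increment (hμ : MeasurePreserving shift μ μ) (k : ℕ) :
    measureEntropy μ shift ≤ ((partitionEntropy μ (block (S := S) 0 (k + 1)) -
      partitionEntropy μ (block (S := S) 0 k) : ℝ) : EReal) := by
  set u : ℕ → ℝ := fun n => partitionEntropy μ (block (S := S) 0 n)
  refine measureEntropy_shift_le hμ (C := u k - k * (u (k + 1) - u k)) fun n => ?_
  have := le_add_mul_of_concave (u := u) (partitionEntropy_block_concave hμ) k n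
  change u n ≤ (u (k + 1) - u k) * n + _
  linarith

/-- The time-zero partition, relabelled by `Fin (card S)`, already has entropy `h`. Increments are
known only from length one on, which leaves a constant offset that disappears after division by `n`.
-/
lemma le_measureEntropy_shift {h : ℝ}
    (hinc : ∀ n, partitionEntropy μ (block (S := S) 0 (n + 2)) -
      partitionEntropy μ (block (S := S) 0 (n + 1)) = h) :
    (h : EReal) ≤ measureEntropy μ shift := by
  set e := Fintype.equivFin S
  have hf : Measurable fun x : ℤ → S => e (x 0) :=
    (measurable_of_finite e).comp (measurable_pi_apply 0)
  refine le_trans ?_ (le_iSup₂_of_le (Fintype.card S) (fun x : ℤ → S => e (x 0))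
    (le_iSup_of_le hf le_rfl))
  have hent : ∀ n, partitionEntropy μ (itinerary shift (fun x : ℤ → S => e (x 0)) n) =
      partitionEntropy μ (block (S := S) 0 n) := by
    intro n
    have hit : ∀ x, itinerary shift (fun x : ℤ → S => e (x 0)) n x = fun i => e (block 0 n x i) :=
      fun x => by rw [← itinerary_shift_eq_block]; rfl
    refine partitionEntropy_eq_of_factor (measurable_block 0 n) ?_ (fun w i => e (w i))
      (fun w i => e.symm (w i)) hit fun x => by simp [hit]
    rw [show itinerary shift (fun x : ℤ → S => e (x 0)) n =
      (fun w i => e (w i)) ∘ block 0 n from funext hit]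
    exact (measurable_of_finite _).comp (measurable_block 0 n)
  have hlin : ∀ n : ℕ, partitionEntropy μ (block (S := S) 0 (n + 1)) =
      partitionEntropy μ (block (S := S) 0 1) + n * h := by
    intro n
    induction n with
    | zero => simp
    | succ n ih =>
      have := hinc n
      push_cast
      linarith
  set c := partitionEntropy μ (block (S := S) 0 1)
  have hlim : Tendsto (fun n : ℕ => ((h + (c - h) / n : ℝ) : EReal)) atTop (nhds (h : EReal)) := by
    refine (continuous_coe_real_ereal.tendsto h).comp ?_
    simpa using (tendsto_const_div_atTop_nhds_zero_nat (c - h)).const_add h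
  rw [← hlim.limsup_eq]
  refine le_of_eq (limsup_congr ?_)
  filter_upwards [eventually_gt_atTop 0] with n hn
  obtain ⟨n, rfl⟩ := Nat.exists_eq_succ_of_ne_zero hn.ne'
  rw [hent, Nat.succ_eq_add_one, hlin]
  congr 1
  push_cast
  field_simp
  ring

end Increments

/-! ### Measures of maximal entropy of an irreducible topological Markov chain -/

section Gibbs

/-- Gibbs' inequality for a single atom, from `log t ≤ t - 1` at `t = y / x`. Strictness of that
bound for `t ≠ 1` gives the equality case `eq_of_mul_log_sub_eq`. -/
lemma sub_le_mul_log_sub {x y : ℝ} (hx : 0 ≤ x) (hy : 0 ≤ y) (h : y = 0 → x = 0) :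
    x - y ≤ x * Real.log x - x * Real.log y := by
  rcases hx.eq_or_lt with rfl | hx
  · simpa
  have hy' : 0 < y := hy.lt_of_ne fun h0 => hx.ne' (h h0.symm)
  have := mul_le_mul_of_nonneg_left (Real.log_le_sub_one_of_pos (div_pos hy' hx)) hx.le
  rw [Real.log_div hy'.ne' hx.ne', mul_sub, mul_sub, mul_div_cancel₀ _ hx.ne'] at this
  linarith

lemma eq_of_mul_log_sub_eq {x y : ℝ} (hx : 0 ≤ x) (hy : 0 ≤ y) (h : y = 0 → x = 0)
    (heq : x * Real.log x - x * Real.log y = x - y) : x = y := by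
  rcases hx.eq_or_lt with rfl | hx
  · simpa [eq_comm] using heq
  have hy' : 0 < y := hy.lt_of_ne fun h0 => hx.ne' (h h0.symm)
  by_contra hne
  have hne' : y / x ≠ 1 := fun h1 => hne ((div_eq_one_iff_eq hx.ne').1 h1).symm
  have := mul_lt_mul_of_pos_left (Real.log_lt_sub_one_of_pos (div_pos hy' hx) hne') hx
  rw [Real.log_div hy'.ne' hx.ne', mul_sub, mul_sub, mul_div_cancel₀ _ hx.ne'] at this
  linarith

end Gibbs

section MaximalEntropy

variable {S : Type*} [Fintype S]

open Classical in
/-- Perron data of an irreducible transition relation: positive left and right eigenvectors for a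
common eigenvalue, normalized against each other, and a state from which all states are
accessible. -/
structure IsPerronData (R : S → S → Prop) (l r : S → ℝ) (lam : ℝ) : Prop where
  left_pos : ∀ s, 0 < l s
  right_pos : ∀ s, 0 < r s
  eigenvalue_pos : 0 < lam
  left_eigen : ∀ t, ∑ s with R s t, l s = lam * l t
  right_eigen : ∀ s, ∑ t with R s t, r t = lam * r s
  sum_mul_eq_one : ∑ s, l s * r s = 1
  exists_root : ∃ s₀, ∀ t, Relation.ReflTransGen R s₀ t

open Classical in
/-- The transition probabilities of the Parry measure. -/
def parryTransition (R : S → S → Prop) (r : S → ℝ) (lam : ℝ) (s t : S) : ℝ :=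
  if R s t then r t / (lam * r s) else 0

variable {R : S → S → Prop} {l r : S → ℝ} {lam : ℝ}

namespace IsPerronData

/-- On allowed pairs `π s * p s t = l s * r t / lam`: row sums come from the right eigenvector,
stationarity from the left one. -/
lemma isStationaryChain (h : IsPerronData R l r lam) :
    IsStationaryChain (fun s => l s * r s) (parryTransition R r lam) where
  nonneg s := (mul_pos (h.left_pos s) (h.right_pos s)).le
  transition_nonneg s t := by
    unfold parryTransition
    split_ifs
    · exact div_nonneg (h.right_pos t).le (mul_pos h.eigenvalue_pos (h.right_pos s)).le
    · rfl
  sum_eq_one := h.sum_mul_eq_one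
  sum_transition s := by
    classical
    unfold parryTransition
    rw [← Finset.sum_filter, ← Finset.sum_div]
    convert div_self (mul_pos h.eigenvalue_pos (h.right_pos s)).ne' using 2
    exact h.right_eigen s
  stationary t := by
    classical
    unfold parryTransition
    have h1 : ∀ s, l s * r s * (if R s t then r t / (lam * r s) else 0) =
        (if R s t then l s else 0) * (r t / lam) := fun s => by
      have := (h.right_pos s).ne'
      have := h.eigenvalue_pos.ne'
      split_ifs
      · field_simp
      · simp
    have h2 := h.left_eigen t
    rw [Finset.sum_filter] at h2
    rw [Finset.sum_congr rfl fun s _ => h1 s, ← Finset.sum_mul]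
    have h3 : ∑ s, (if R s t then l s else 0) = lam * l t := by
      convert h2
    rw [h3]
    have := h.eigenvalue_pos.ne'
    field_simp

/-- A left eigenvector is dominated by the multiple of `l` with the same value at the root. -/
lemma le_of_left_eigen (h : IsPerronData R l r lam) {s₀ : S}
    (hs₀ : ∀ t, Relation.ReflTransGen R s₀ t) {v : S → ℝ}
    (hv : ∀ t, ∑ s, (open Classical in if R s t then v s else 0) = lam * v t) (t : S) :
    v t ≤ v s₀ / l s₀ * l t := by
  classical
  have : Nonempty S := ⟨s₀⟩
  -- Maximum principle for `v / l`: the eigenvector equations propagate the maximal value from `t₀`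
  -- to all its predecessors, hence back to `s₀`.
  obtain ⟨t₀, ht₀⟩ := Finite.exists_max fun s => v s / l s
  set c := v t₀ / l t₀
  have hc : ∀ s, v s ≤ c * l s := fun s => (div_le_iff₀ (h.left_pos s)).1 (ht₀ s)
  have hc₀ : v t₀ = c * l t₀ := (div_mul_cancel₀ _ (h.left_pos t₀).ne').symm
  have hanc : ∀ s, Relation.ReflTransGen R s t₀ → v s = c * l s := by
    intro s hs
    induction hs using Relation.ReflTransGen.head_induction_on with
    | refl => exact hc₀
    | @head a b hab _ ih =>
      have hl : ∑ s, (if R s b then l s else 0) = lam * l b := by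
        rw [← Finset.sum_filter]
        convert h.left_eigen b
      have hvb : ∑ s, (if R s b then v s else 0) = lam * v b := by
        convert hv b
      have h0 : ∑ s, (if R s b then c * l s - v s else 0) = 0 := by
        have : ∀ s, (if R s b then c * l s - v s else 0) =
            c * (if R s b then l s else 0) - (if R s b then v s else 0) := fun s => by
          split_ifs <;> simp
        rw [Finset.sum_congr rfl fun s _ => this s, Finset.sum_sub_distrib, ← Finset.mul_sum, hl,
          hvb, ih]
        ring
      have h1 := (Finset.sum_eq_zero_iff_of_nonneg fun s _ => by
        split_ifs
        · exact sub_nonneg.2 (hc s)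
        · rfl).1 h0 a (Finset.mem_univ a)
      rw [if_pos hab] at h1
      linarith
  rw [hanc s₀ (hs₀ t₀), mul_div_cancel_right₀ _ (h.left_pos s₀).ne']
  exact hc t

/-- The Parry chain has a unique stationary law. -/
lemma eq_of_stationary (h : IsPerronData R l r lam) {u : S → ℝ} (hu : ∑ s, u s = 1)
    (hstat : ∀ t, ∑ s, u s * parryTransition R r lam s t = u t) (t : S) : u t = l t * r t := by
  classical
  obtain ⟨s₀, hs₀⟩ := h.exists_root
  -- Division by `r` turns stationarity into the left eigenvector equation. Domination applied to
  -- both `v` and `-v` then makes `v` proportional to `l`.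
  set v : S → ℝ := fun s => u s / r s
  have huv : ∀ s, u s = v s * r s := fun s => (div_mul_cancel₀ _ (h.right_pos s).ne').symm
  have hv : ∀ t, ∑ s, (open Classical in if R s t then v s else 0) = lam * v t := by
    intro t
    have h1 := hstat t
    have h2 : ∀ s, u s * parryTransition R r lam s t =
        (open Classical in if R s t then v s else 0) * (r t / lam) := fun s => by
      have h3 := (h.right_pos s).ne'
      have := h.eigenvalue_pos.ne'
      unfold parryTransition
      rw [huv]
      split_ifs
      · field_simp
      · simp
    rw [Finset.sum_congr rfl fun s _ => h2 s, ← Finset.sum_mul, huv t, mul_div_assoc',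
      div_eq_iff h.eigenvalue_pos.ne'] at h1
    have h4 := (h.right_pos t).ne'
    refine mul_right_cancel₀ h4 (h1.trans ?_)
    ring
  have hle := h.le_of_left_eigen hs₀ hv
  have hge := h.le_of_left_eigen hs₀ (v := fun s => -v s) fun t => by
    rw [mul_neg, ← hv t, ← Finset.sum_neg_distrib]
    exact Finset.sum_congr rfl fun s _ => by split_ifs <;> simp
  set c := v s₀ / l s₀
  have hvc : ∀ t, v t = c * l t := fun t => by
    have := hge t
    rw [neg_div, neg_mul] at this
    exact le_antisymm (hle t) (neg_le_neg_iff.1 this)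
  have hc : c = 1 := by
    have h1 : ∑ s, u s = c * ∑ s, l s * r s := by
      rw [Finset.mul_sum]
      exact Finset.sum_congr rfl fun s _ => by rw [huv, hvc, mul_assoc]
    rw [hu, h.sum_mul_eq_one, mul_one] at h1
    exact h1.symm
  rw [huv, hvc, hc, one_mul]

variable [MeasurableSpace S] [MeasurableSingletonClass S]

lemma measureReal_block_eq_zero {μ : Measure (ℤ → S)} (hμ : ∀ᵐ x ∂μ, x ∈ pathSpace R) (a : ℤ)
    {n : ℕ} {w : Fin (n + 1) → S} {t : S} (hR : ¬R (w (Fin.last n)) t) :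
    μ.real (block a (n + 2) ⁻¹' {Fin.snoc w t}) = 0 := by
  rw [measureReal_def, ENNReal.toReal_eq_zero_iff]
  left
  refine measure_mono_null (fun x hx => ?_) (ae_iff.1 hμ)
  intro hx'
  rw [preimage_block_snoc] at hx
  have h1 : x (a + n) = w (Fin.last n) := by
    rw [← show block a (n + 1) x = w from hx.1]
    simp [block]
  have h2 : x (a + (n + 1 : ℕ)) = t := hx.2
  have h3 := hx' (a + n)
  rw [h1, show a + (n : ℤ) + 1 = a + ((n + 1 : ℕ) : ℤ) by push_cast; ring, h2] at h3
  exact hR h3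

lemma sum_measureReal_mul {Ω : Type*} [MeasurableSpace Ω] {μ : Measure Ω} [IsFiniteMeasure μ]
    {ι κ : Type*} [Fintype ι] [Fintype κ] [MeasurableSpace ι] [MeasurableSingletonClass ι]
    {f : Ω → ι} (hf : Measurable f) (g : ι → κ) (φ : κ → ℝ) :
    ∑ i, μ.real (f ⁻¹' {i}) * φ (g i) = ∑ j, μ.real ((fun x => g (f x)) ⁻¹' {j}) * φ j := by
  classical
  rw [← Finset.sum_fiberwise _ g]
  refine Finset.sum_congr rfl fun j _ => ?_
  rw [measureReal_preimage_comp hf, Finset.sum_mul]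
  exact Finset.sum_congr rfl fun i hi => by rw [(Finset.mem_filter.1 hi).2]

lemma measureReal_preimage_apply_eq {μ : Measure (ℤ → S)} (hμ : MeasurePreserving shift μ μ)
    (k : ℕ) (s : S) :
    μ.real ((fun x : ℤ → S => x k) ⁻¹' {s}) = μ.real ((fun x : ℤ → S => x 0) ⁻¹' {s}) := by
  rw [← (hμ.iterate k).measureReal_preimage
    ((measurable_pi_apply 0) (measurableSet_singleton s)).nullMeasurableSet]
  congr 1
  ext x
  simp [shift_iterate_apply]

lemma sum_snoc {M : Type*} [AddCommMonoid M] (n : ℕ) (F : (Fin (n + 1) → S) → M) :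
    ∑ w, F w = ∑ w : Fin n → S, ∑ t, F (Fin.snoc w t) := by
  rw [← (Fin.snocEquiv fun _ : Fin (n + 1) => S).sum_comp, Fintype.sum_prod_type_right]
  rfl

/-- The entropy increment falls short of `log lam` by the relative entropy of the transitions of
`μ` with respect to the Parry transitions. -/
lemma increment_eq (h : IsPerronData R l r lam) {μ : Measure (ℤ → S)} (hμ : IsInvariantProb R μ)
    (n : ℕ) :
    partitionEntropy μ (block (S := S) 0 (n + 2)) - partitionEntropy μ (block (S := S) 0 (n + 1)) =
      Real.log lam - ∑ w : Fin (n + 1) → S, ∑ t,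
        (μ.real (block 0 (n + 2) ⁻¹' {Fin.snoc w t}) *
            Real.log (μ.real (block 0 (n + 2) ⁻¹' {Fin.snoc w t})) -
          μ.real (block 0 (n + 2) ⁻¹' {Fin.snoc w t}) *
            Real.log (μ.real (block 0 (n + 1) ⁻¹' {w}) *
              parryTransition R r lam (w (Fin.last n)) t)) := by
  have := hμ.isProbabilityMeasure
  set q : (Fin (n + 1) → S) → S → ℝ := fun w t => μ.real (block 0 (n + 2) ⁻¹' {Fin.snoc w t})
    with hq
  set m : (Fin (n + 1) → S) → ℝ := fun w => μ.real (block 0 (n + 1) ⁻¹' {w}) with hm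
  have hqm : ∀ w, ∑ t, q w t = m w := fun w => sum_measureReal_block_snoc μ 0 (n + 1) w
  have hq0 : ∀ w t, 0 ≤ q w t := fun _ _ => measureReal_nonneg
  have hm0 : ∀ w, 0 ≤ m w := fun _ => measureReal_nonneg
  have hsum : ∑ w, m w = 1 := by
    simpa using sum_measureReal_preimage_singleton (μ := μ) Finset.univ (f := block (S := S) 0 (n + 1))
      fun y _ => measurableSet_preimage_block 0 _ y
  have hterm : ∀ w t, q w t * Real.log (m w * parryTransition R r lam (w (Fin.last n)) t) =
      q w t * Real.log (m w) + q w t * Real.log (r t) - q w t * Real.log lam -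
        q w t * Real.log (r (w (Fin.last n))) := by
    intro w t
    rcases (hq0 w t).eq_or_lt with h0 | h0
    · rw [← h0]; simp
    · have hR : R (w (Fin.last n)) t := by
        by_contra hR
        exact h0.ne' (measureReal_block_eq_zero hμ.ae_mem 0 hR)
      have hmw : 0 < m w := by
        rw [← hqm]
        exact h0.trans_le (Finset.single_le_sum (fun t _ => hq0 w t) (Finset.mem_univ t))
      have h1 := h.right_pos t
      have h2 := h.right_pos (w (Fin.last n))
      have h3 := h.eigenvalue_pos
      rw [parryTransition, if_pos hR, Real.log_mul hmw.ne' (by positivity),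
        Real.log_div h1.ne' (by positivity), Real.log_mul h3.ne' h2.ne']
      ring
  -- By shift invariance the averages of `log r` at the last two letters agree, so the eigenvector
  -- drops out and only `log lam` survives.
  have hA : ∑ w : Fin (n + 1) → S, ∑ t, q w t * Real.log (r t) =
      ∑ s, μ.real ((fun x : ℤ → S => x 0) ⁻¹' {s}) * Real.log (r s) := by
    have := sum_measureReal_mul (μ := μ) (measurable_block (S := S) 0 (n + 2))
      (fun w => w (Fin.last (n + 1))) fun s => Real.log (r s)
    rw [sum_snoc (n + 1)] at this
    simp only [Fin.snoc_last] at this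
    rw [this]
    refine Finset.sum_congr rfl fun s _ => ?_
    rw [← measureReal_preimage_apply_eq hμ.measurePreserving (n + 1)]
    simp [block]
  have hB : ∑ w : Fin (n + 1) → S, m w * Real.log (r (w (Fin.last n))) =
      ∑ s, μ.real ((fun x : ℤ → S => x 0) ⁻¹' {s}) * Real.log (r s) := by
    rw [sum_measureReal_mul (μ := μ) (measurable_block (S := S) 0 (n + 1))
      (fun w => w (Fin.last n)) fun s => Real.log (r s)]
    refine Finset.sum_congr rfl fun s _ => ?_
    rw [← measureReal_preimage_apply_eq hμ.measurePreserving n]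
    simp [block]
  have hH : partitionEntropy μ (block (S := S) 0 (n + 2)) =
      -∑ w : Fin (n + 1) → S, ∑ t, q w t * Real.log (q w t) := by
    rw [partitionEntropy, sum_snoc (n + 1)]
    simp [Real.negMulLog, hq]
  have hH' : partitionEntropy μ (block (S := S) 0 (n + 1)) = -∑ w, m w * Real.log (m w) := by
    simp [partitionEntropy, Real.negMulLog, hm]
  change _ = Real.log lam - ∑ w, ∑ t, (q w t * Real.log (q w t) -
    q w t * Real.log (m w * parryTransition R r lam (w (Fin.last n)) t))
  simp only [hterm, Finset.sum_sub_distrib, Finset.sum_add_distrib]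
  rw [hA]
  simp only [← Finset.sum_mul, hqm, hsum]
  rw [hB, hH, hH']
  ring

/-- The law `q` and the Parry prediction `m * p` have equal mass, so the relative entropy in
`increment_eq` is nonnegative; when it vanishes, Gibbs' inequality is an equality term by term. -/
lemma increment_le (h : IsPerronData R l r lam) {μ : Measure (ℤ → S)} (hμ : IsInvariantProb R μ)
    (n : ℕ) :
    partitionEntropy μ (block (S := S) 0 (n + 2)) -
      partitionEntropy μ (block (S := S) 0 (n + 1)) ≤ Real.log lam ∧
    (partitionEntropy μ (block (S := S) 0 (n + 2)) -
        partitionEntropy μ (block (S := S) 0 (n + 1)) = Real.log lam →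
      ∀ (w : Fin (n + 1) → S) t, μ.real (block 0 (n + 2) ⁻¹' {Fin.snoc w t}) =
        μ.real (block 0 (n + 1) ⁻¹' {w}) * parryTransition R r lam (w (Fin.last n)) t) := by
  have := hμ.isProbabilityMeasure
  rw [h.increment_eq hμ]
  set q : (Fin (n + 1) → S) → S → ℝ := fun w t => μ.real (block 0 (n + 2) ⁻¹' {Fin.snoc w t})
    with hq
  set m : (Fin (n + 1) → S) → ℝ := fun w => μ.real (block 0 (n + 1) ⁻¹' {w}) with hm
  set p := parryTransition R r lam
  have hqm : ∀ w, ∑ t, q w t = m w := fun w => sum_measureReal_block_snoc μ 0 (n + 1) w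
  have hq0 : ∀ w t, 0 ≤ q w t := fun _ _ => measureReal_nonneg
  have hm0 : ∀ w, 0 ≤ m w := fun _ => measureReal_nonneg
  have hp0 := h.isStationaryChain.transition_nonneg
  have hy0 : ∀ w t, 0 ≤ m w * p (w (Fin.last n)) t := fun w t => mul_nonneg (hm0 w) (hp0 _ _)
  have habs : ∀ w t, m w * p (w (Fin.last n)) t = 0 → q w t = 0 := by
    intro w t h0
    rcases mul_eq_zero.1 h0 with h0 | h0
    · refine le_antisymm ?_ (hq0 w t)
      rw [← h0, ← hqm]
      exact Finset.single_le_sum (fun t _ => hq0 w t) (Finset.mem_univ t)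
    · refine measureReal_block_eq_zero hμ.ae_mem 0 fun hR => ?_
      have h1 := h.right_pos t
      have h2 := h.right_pos (w (Fin.last n))
      have h3 := h.eigenvalue_pos
      have : 0 < p (w (Fin.last n)) t := by
        simp only [p, parryTransition, if_pos hR]
        positivity
      exact this.ne' h0
  have hle : ∀ w t, q w t - m w * p (w (Fin.last n)) t ≤
      q w t * Real.log (q w t) - q w t * Real.log (m w * p (w (Fin.last n)) t) := fun w t =>
    sub_le_mul_log_sub (hq0 w t) (hy0 w t) (habs w t)
  have hzero : ∑ w, ∑ t, (q w t - m w * p (w (Fin.last n)) t) = 0 := by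
    refine Finset.sum_eq_zero fun w _ => ?_
    rw [Finset.sum_sub_distrib, ← Finset.mul_sum, hqm, h.isStationaryChain.sum_transition]
    ring
  have hsum := Finset.sum_le_sum fun w (_ : w ∈ Finset.univ) =>
    Finset.sum_le_sum fun t (_ : t ∈ Finset.univ) => hle w t
  rw [hzero] at hsum
  refine ⟨by linarith, fun heq w t => ?_⟩
  refine eq_of_mul_log_sub_eq (hq0 w t) (hy0 w t) (habs w t) ?_
  have h1 : ∑ w, ∑ t, (q w t - m w * p (w (Fin.last n)) t) = ∑ w, ∑ t, (q w t * Real.log (q w t) -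
      q w t * Real.log (m w * p (w (Fin.last n)) t)) := by
    rw [hzero]
    linarith
  have h2 := (Finset.sum_eq_sum_iff_of_le fun w _ =>
    Finset.sum_le_sum fun t (_ : t ∈ Finset.univ) => hle w t).1 h1 w (Finset.mem_univ w)
  exact ((Finset.sum_eq_sum_iff_of_le fun t _ => hle w t).1 h2 t (Finset.mem_univ t)).symm

lemma measureEntropy_le (h : IsPerronData R l r lam) {μ : Measure (ℤ → S)}
    (hμ : IsInvariantProb R μ) : measureEntropy μ shift ≤ (Real.log lam : EReal) := by
  have := hμ.isProbabilityMeasure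
  refine (measureEntropy_shift_le_increment hμ.measurePreserving 1).trans ?_
  exact_mod_cast (h.increment_le hμ 0).1

/-- Invariant measures of full entropy have the block laws of the Parry chain. -/
lemma hasMarkovBlock_of_le_measureEntropy (h : IsPerronData R l r lam) {μ : Measure (ℤ → S)}
    (hμ : IsInvariantProb R μ) (hent : (Real.log lam : EReal) ≤ measureEntropy μ shift)
    (a : ℤ) (n : ℕ) :
    HasMarkovBlock (fun s => l s * r s) (parryTransition R r lam) μ a n := by
  have := hμ.isProbabilityMeasure
  -- The entropy is at most each increment and each increment is at most `log lam`, so full entropy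
  -- saturates all of them.
  have hstep : ∀ (n : ℕ) (w : Fin (n + 1) → S) t, μ.real (block 0 (n + 2) ⁻¹' {Fin.snoc w t}) =
      μ.real (block 0 (n + 1) ⁻¹' {w}) * parryTransition R r lam (w (Fin.last n)) t := fun n =>
    (h.increment_le hμ n).2 <| (h.increment_le hμ n).1.antisymm <| by
      exact_mod_cast hent.trans (measureEntropy_shift_le_increment hμ.measurePreserving (n + 1))
  have h0 : ∀ n, HasMarkovBlock (fun s => l s * r s) (parryTransition R r lam) μ 0 n := by
    intro n
    induction n with
    | zero =>
      set u : S → ℝ := fun s => μ.real (block (S := S) 0 1 ⁻¹' {fun _ => s}) with hu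
      have hsum : ∑ s, u s = 1 := by
        have h1 := measureReal_eq_sum_inter μ (measurable_pi_apply (X := fun _ : ℤ => S) 0) Set.univ
        rw [probReal_univ] at h1
        rw [h1]
        refine Finset.sum_congr rfl fun s _ => congrArg μ.real ?_
        ext x
        simp [block, funext_iff]
      have hstat : ∀ t, ∑ s, u s * parryTransition R r lam s t = u t := by
        intro t
        have h1 := sum_measureReal_block_cons μ 0 1 fun _ => t
        have h2 : μ.real (block (S := S) (0 + 1) 1 ⁻¹' {fun _ => t}) = u t := by
          rw [← map_measureReal_apply (measurable_block _ _) (measurableSet_singleton _),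
            map_block_eq hμ.measurePreserving,
            map_measureReal_apply (measurable_block _ _) (measurableSet_singleton _)]
        rw [h2] at h1
        rw [← h1]
        refine Finset.sum_congr rfl fun s _ => ?_
        have h3 := hstep 0 (fun _ => s) t
        rw [← h3]
        congr 3
        ext i
        fin_cases i <;> rfl
      intro w
      have := h.eq_of_stationary hsum hstat (w 0)
      rw [markovWeight]
      simp only [Finset.univ_eq_empty, Finset.prod_empty, mul_one]
      rw [← this]
      simp only [hu]
      congr 3
      ext i
      rw [show i = 0 from Fin.ext (by omega)]
    | succ n ih =>
      intro w
      rw [← Fin.snoc_init_self w, markovWeight_snoc, hstep, ih]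
  intro w
  rw [← h0 n w, ← map_measureReal_apply (measurable_block _ _) (measurableSet_singleton _),
    map_block_eq hμ.measurePreserving,
    map_measureReal_apply (measurable_block _ _) (measurableSet_singleton _)]

/-- The Parry measure. -/
lemma exists_parry (h : IsPerronData R l r lam) :
    ∃ μ : Measure (ℤ → S), IsInvariantProb R μ ∧
      (∀ a n, HasMarkovBlock (fun s => l s * r s) (parryTransition R r lam) μ a n) ∧
      measureEntropy μ shift = (Real.log lam : EReal) := by
  obtain ⟨μ, hprob, hblock⟩ := h.isStationaryChain.exists_measure
  have hshift : Measurable (shift (S := S)) := measurable_pi_lambda _ fun _ => measurable_pi_apply _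
  have hinv : IsInvariantProb R μ := by
    refine ⟨hprob, ⟨hshift, ?_⟩, ?_⟩
    · have : IsProbabilityMeasure (μ.map shift) :=
        Measure.isProbabilityMeasure_map hshift.aemeasurable
      refine eq_of_measureReal_block_eq fun a n w => ?_
      rw [map_measureReal_apply hshift (measurableSet_preimage_block _ _ _), hblock a n w,
        ← hblock (a + 1) n w]
      congr 1
      ext x
      simp [block_shift]
    · refine ae_all_iff.2 fun k => ?_
      rw [ae_iff]
      have hsub : {x : ℤ → S | ¬R (x k) (x (k + 1))} ⊆
          ⋃ w ∈ {w : Fin 2 → S | ¬R (w 0) (w 1)}, block k 2 ⁻¹' {w} := by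
        intro x hx
        refine Set.mem_biUnion (x := block k 2 x) ?_ rfl
        simpa [block] using hx
      refine measure_mono_null hsub ((measure_biUnion_null_iff (Set.to_countable _)).2 ?_)
      intro w hw
      have h1 := hblock k 1 w
      have h2 : markovWeight (fun s => l s * r s) (parryTransition R r lam) w = 0 := by
        have hw' : ¬R (w 0) (w 1) := hw
        simp [markovWeight, parryTransition, hw']
      rw [h2, measureReal_def, ENNReal.toReal_eq_zero_iff] at h1
      exact h1.resolve_right (measure_ne_top _ _)
  refine ⟨μ, hinv, hblock, (h.measureEntropy_le hinv).antisymm (le_measureEntropy_shift fun n => ?_)⟩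
  -- For Parry block laws every relative entropy term is zero, so each increment equals `log lam`.
  rw [h.increment_eq hinv, sub_eq_self]
  refine Finset.sum_eq_zero fun w _ => Finset.sum_eq_zero fun t _ => ?_
  rw [hblock 0 (n + 1), hblock 0 n, markovWeight_snoc, sub_self]

lemma isMaximalEntropyMeasure_iff (h : IsPerronData R l r lam) {μ : Measure (ℤ → S)} :
    IsMaximalEntropyMeasure R μ ↔ IsInvariantProb R μ ∧
      ∀ a n, HasMarkovBlock (fun s => l s * r s) (parryTransition R r lam) μ a n := by
  obtain ⟨ν, hν, hνb, hνe⟩ := h.exists_parry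
  constructor
  · rintro ⟨h1, h2⟩
    exact ⟨h1, h.hasMarkovBlock_of_le_measureEntropy h1 (hνe ▸ h2 ν hν)⟩
  · rintro ⟨h1, h2⟩
    have := h1.isProbabilityMeasure
    have := hν.isProbabilityMeasure
    have hμν : μ = ν := eq_of_measureReal_block_eq fun a n w => (h2 a n w).trans (hνb a n w).symm
    refine ⟨h1, fun ν' hν' => ?_⟩
    rw [hμν, hνe]
    exact h.measureEntropy_le hν'

/-- An irreducible topological Markov chain has a unique measure of maximal entropy. -/
theorem existsUnique_isMaximalEntropyMeasure (h : IsPerronData R l r lam) :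
    ∃! μ : Measure (ℤ → S), IsMaximalEntropyMeasure R μ := by
  obtain ⟨ν, hν, hνb, -⟩ := h.exists_parry
  refine ⟨ν, h.isMaximalEntropyMeasure_iff.2 ⟨hν, hνb⟩, fun μ hμ => ?_⟩
  obtain ⟨h1, h2⟩ := h.isMaximalEntropyMeasure_iff.1 hμ
  have := h1.isProbabilityMeasure
  have := hν.isProbabilityMeasure
  exact eq_of_measureReal_block_eq fun a n w => (h2 a n w).trans (hνb a n w).symm

/-- The one-time marginal of a measure of maximal entropy. -/
theorem measureReal_state (h : IsPerronData R l r lam) {μ : Measure (ℤ → S)}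
    (hμ : IsMaximalEntropyMeasure R μ) (s : S) :
    μ.real ((fun x : ℤ → S => x 0) ⁻¹' {s}) = l s * r s := by
  have h1 := (h.isMaximalEntropyMeasure_iff.1 hμ).2 0 0 fun _ => s
  simp only [markovWeight, Finset.univ_eq_empty, Finset.prod_empty, mul_one] at h1
  rw [← h1]
  congr 1
  ext x
  simp [block, funext_iff]

end IsPerronData

end MaximalEntropy

/-! ### Topological entropy of an irreducible topological Markov chain -/

section TopologicalEntropy

lemma exists_window_of_mem_uniformity {S : Type*} [UniformSpace S] [DiscreteUniformity S]
    {U : SetRel (ℤ → S) (ℤ → S)} (hU : U ∈ uniformity (ℤ → S)) :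
    ∃ m : ℕ, ∀ x y : ℤ → S, (∀ k : ℤ, |k| ≤ m → x k = y k) → (x, y) ∈ U := by
  rw [Pi.uniformity, Filter.mem_iInf] at hU
  obtain ⟨I, hI, V, hV, rfl⟩ := hU
  refine ⟨hI.toFinset.sup Int.natAbs, fun x y hxy => Set.mem_iInter.2 fun i => ?_⟩
  obtain ⟨W, hW, hWV⟩ := Filter.mem_comap.1 (hV i)
  refine hWV ?_
  rw [DiscreteUniformity.eq_bot (X := S)] at hW
  have hle : i.1.natAbs ≤ hI.toFinset.sup Int.natAbs :=
    Finset.le_sup (f := Int.natAbs) (hI.mem_toFinset.2 i.2)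
  have hi : x i = y i := hxy i (by rw [Int.abs_eq_natAbs]; exact_mod_cast hle)
  have hid : (SetRel.id : SetRel S S) ⊆ W := by
    rw [bot_uniformity] at hW
    exact hW
  exact hid hi

variable {S : Type*} [Fintype S] {R : S → S → Prop} {l r : S → ℝ} {lam : ℝ}

namespace IsPerronData

/-- The factors `r` telescope along an allowed word, leaving only its endpoints and its length. -/
lemma markovWeight_eq_zero_or (h : IsPerronData R l r lam) (n : ℕ) (w : Fin (n + 1) → S) :
    markovWeight (fun s => l s * r s) (parryTransition R r lam) w = 0 ∨
      markovWeight (fun s => l s * r s) (parryTransition R r lam) w * lam ^ n =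
        l (w 0) * r (w (Fin.last n)) := by
  have hlam := h.eigenvalue_pos.ne'
  induction n with
  | zero => right; simp [markovWeight]
  | succ n ih =>
    rw [← Fin.snoc_init_self w, markovWeight_snoc]
    rcases ih (Fin.init w) with h0 | h0
    · left; rw [h0, zero_mul]
    · by_cases hR : R (Fin.init w (Fin.last n)) (w (Fin.last (n + 1)))
      · right
        have hr := (h.right_pos (Fin.init w (Fin.last n))).ne'
        rw [parryTransition, if_pos hR, Fin.snoc_last]
        have h1 : (Fin.snoc (Fin.init w) (w (Fin.last (n + 1))) : Fin (n + 2) → S) 0 =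
            Fin.init w 0 := Fin.snoc_castSucc (α := fun _ => S) _ (Fin.init w) 0
        rw [h1]
        field_simp
        linear_combination r (w (Fin.last (n + 1))) * lam * h0
      · left; rw [parryTransition, if_neg hR, mul_zero]

lemma markovWeight_block_pos (h : IsPerronData R l r lam) {x : ℤ → S} (hx : x ∈ pathSpace R)
    (a : ℤ) (n : ℕ) :
    0 < markovWeight (fun s => l s * r s) (parryTransition R r lam) (block a (n + 1) x) := by
  refine mul_pos (mul_pos (h.left_pos _) (h.right_pos _)) (Finset.prod_pos fun i _ => ?_)
  have hR : R (block a (n + 1) x i.castSucc) (block a (n + 1) x i.succ) := by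
    have := hx (a + (i : ℕ))
    simp only [block, Fin.val_castSucc, Fin.val_succ]
    convert this using 2
    push_cast
    ring
  rw [parryTransition, if_pos hR]
  exact div_pos (h.right_pos _) (mul_pos h.eigenvalue_pos (h.right_pos _))

open Classical in
/-- The words of length `n + 1` allowed by the chain. -/
def allowedWords (R : S → S → Prop) (l r : S → ℝ) (lam : ℝ) (n : ℕ) : Finset (Fin (n + 1) → S) :=
  {w | 0 < markovWeight (fun s => l s * r s) (parryTransition R r lam) w}

/-- The number of allowed words grows like `lam ^ n`. -/
lemma exists_card_allowedWords_bounds (h : IsPerronData R l r lam) :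
    ∃ c C : ℝ, 0 < c ∧ 0 < C ∧ ∀ n, c * lam ^ n ≤ (allowedWords R l r lam n).card ∧
      ((allowedWords R l r lam n).card : ℝ) ≤ C * lam ^ n := by
  classical
  obtain ⟨s₀, -⟩ := h.exists_root
  have : Nonempty S := ⟨s₀⟩
  obtain ⟨⟨a₁, b₁⟩, hmin⟩ := Finite.exists_min fun q : S × S => l q.1 * r q.2
  obtain ⟨⟨a₂, b₂⟩, hmax⟩ := Finite.exists_max fun q : S × S => l q.1 * r q.2
  simp only [Prod.forall] at hmin hmax
  have hk : 0 < l a₁ * r b₁ := mul_pos (h.left_pos _) (h.right_pos _)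
  have hK : 0 < l a₂ * r b₂ := mul_pos (h.left_pos _) (h.right_pos _)
  refine ⟨(l a₂ * r b₂)⁻¹, (l a₁ * r b₁)⁻¹, inv_pos.2 hK, inv_pos.2 hk, fun n => ?_⟩
  have hpow : 0 < lam ^ n := pow_pos h.eigenvalue_pos n
  -- The weights add up to one, and each multiplied by `lam ^ n` lies between the extreme values of
  -- `l a * r b`; this counts the words.
  have hsum : ∑ w ∈ allowedWords R l r lam n,
      markovWeight (fun s => l s * r s) (parryTransition R r lam) w * lam ^ n = lam ^ n := by
    rw [← Finset.sum_mul]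
    convert one_mul _
    rw [← h.isStationaryChain.sum_markovWeight n]
    refine Finset.sum_subset (Finset.subset_univ _) fun w _ hw => ?_
    have h1 := h.isStationaryChain.markovWeight_nonneg w
    simp only [allowedWords, Finset.mem_filter, Finset.mem_univ, true_and, not_lt] at hw
    exact hw.antisymm h1
  have hval : ∀ w ∈ allowedWords R l r lam n,
      markovWeight (fun s => l s * r s) (parryTransition R r lam) w * lam ^ n =
        l (w 0) * r (w (Fin.last n)) := fun w hw =>
    (h.markovWeight_eq_zero_or n w).resolve_left (by
      simp only [allowedWords, Finset.mem_filter, Finset.mem_univ, true_and] at hw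
      exact hw.ne')
  constructor
  · have := Finset.sum_le_card_nsmul _ _ (l a₂ * r b₂) fun w hw =>
      (hval w hw).trans_le (hmax (w 0) (w (Fin.last n)))
    rw [hsum, nsmul_eq_mul] at this
    rw [inv_mul_le_iff₀ hK]
    linarith
  · have := Finset.card_nsmul_le_sum _ _ (l a₁ * r b₁) fun w hw =>
      (hmin (w 0) (w (Fin.last n))).trans_eq (hval w hw).symm
    rw [hsum, nsmul_eq_mul] at this
    rw [← div_eq_inv_mul, le_div_iff₀ hk]
    exact this

/-- The Parry measure charges the cylinder of an allowed word and is carried by the path space, so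
the two sets meet. -/
lemma exists_mem_pathSpace (h : IsPerronData R l r lam) (a : ℤ) {n : ℕ} {w : Fin (n + 1) → S}
    (hw : w ∈ allowedWords R l r lam n) : ∃ x ∈ pathSpace R, block a (n + 1) x = w := by
  let _ : MeasurableSpace S := ⊤
  obtain ⟨μ, hμ, hblock, -⟩ := h.exists_parry
  have := hμ.isProbabilityMeasure
  simp only [allowedWords, Finset.mem_filter, Finset.mem_univ, true_and] at hw
  rw [← hblock a n w] at hw
  by_contra! hcon
  refine hw.ne' ?_
  rw [measureReal_def, ENNReal.toReal_eq_zero_iff]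
  exact Or.inl (measure_mono_null (fun x hx hx' => hcon x hx' hx) (ae_iff.1 hμ.ae_mem))

variable [UniformSpace S] [DiscreteUniformity S]

/-- Trajectories that agree on `[-m, n + m]` stay `U`-close for `n` steps, so one trajectory per
allowed word there is a dynamical cover. The extra letters cost a constant factor. -/
lemma coverEntropy_le (h : IsPerronData R l r lam) :
    Dynamics.coverEntropy shift (pathSpace R) ≤ (Real.log lam : EReal) := by
  classical
  obtain ⟨c, C, hc, hC, hcard⟩ := h.exists_card_allowedWords_bounds
  have hlam := h.eigenvalue_pos
  refine iSup₂_le fun U hU => ?_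
  obtain ⟨m, hm⟩ := exists_window_of_mem_uniformity hU
  rw [← ENNReal.log_ofReal_of_pos hlam, ← ExpGrowth.expGrowthSup_pow]
  refine ExpGrowth.expGrowthSup_le_of_eventually_le (b := ENNReal.ofReal (C * lam ^ (2 * m)))
    ENNReal.ofReal_ne_top (Eventually.of_forall fun n => ?_)
  have hex : ∀ w, ∃ x : ℤ → S, w ∈ allowedWords R l r lam (n + 2 * m) →
      x ∈ pathSpace R ∧ block (-(m : ℤ)) (n + 2 * m + 1) x = w := by
    intro w
    by_cases hw : w ∈ allowedWords R l r lam (n + 2 * m)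
    · obtain ⟨x, hx⟩ := h.exists_mem_pathSpace (-(m : ℤ)) hw
      exact ⟨x, fun _ => hx⟩
    · exact ⟨fun _ => w 0, fun hw' => absurd hw' hw⟩
  choose e he using hex
  have hcover : Dynamics.IsDynCoverOf shift (pathSpace R) U n
      ((allowedWords R l r lam (n + 2 * m)).image e : Finset (ℤ → S)) := by
    intro x hx
    have hw : block (-(m : ℤ)) (n + 2 * m + 1) x ∈ allowedWords R l r lam (n + 2 * m) := by
      simp only [allowedWords, Finset.mem_filter, Finset.mem_univ, true_and]
      exact h.markovWeight_block_pos hx _ _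
    refine ⟨_, Finset.mem_coe.2 (Finset.mem_image_of_mem e hw), ?_⟩
    rw [Dynamics.mem_dynEntourage]
    intro k hk
    refine hm _ _ fun j hj => ?_
    have hj' := abs_le.1 hj
    have := congrFun (he _ hw).2 ⟨(j + m + k).toNat, by omega⟩
    simp only [block] at this
    rw [show (-(m : ℤ) + ((j + m + k).toNat : ℕ)) = j + k by omega] at this
    rw [shift_iterate_apply, shift_iterate_apply, this]
  have h1 := hcover.coverMincard_le_card.trans (Nat.cast_le.2 Finset.card_image_le)
  have h2 := (hcard (n + 2 * m)).2
  calc (Dynamics.coverMincard shift (pathSpace R) U n : ENNReal)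
      ≤ (((allowedWords R l r lam (n + 2 * m)).card : ℕ∞) : ENNReal) := ENat.toENNReal_mono h1
    _ = ENNReal.ofReal ((allowedWords R l r lam (n + 2 * m)).card : ℝ) := by simp
    _ ≤ ENNReal.ofReal (C * lam ^ (n + 2 * m)) := ENNReal.ofReal_le_ofReal h2
    _ = ENNReal.ofReal (C * lam ^ (2 * m)) * ENNReal.ofReal lam ^ n := by
        rw [← ENNReal.ofReal_pow hlam.le, ← ENNReal.ofReal_mul (by positivity)]
        congr 1
        ring

/-- For the entourage "same letter at time zero", trajectories with different words have disjoint
dynamical balls, so the allowed words yield a net. -/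
lemma le_coverEntropy (h : IsPerronData R l r lam) :
    (Real.log lam : EReal) ≤ Dynamics.coverEntropy shift (pathSpace R) := by
  classical
  obtain ⟨c, C, hc, hC, hcard⟩ := h.exists_card_allowedWords_bounds
  have hlam := h.eigenvalue_pos
  set U : SetRel (ℤ → S) (ℤ → S) := {p | p.1 0 = p.2 0} with hUdef
  have hU : U ∈ uniformity (ℤ → S) := by
    have h1 := Pi.uniformContinuous_proj (fun _ : ℤ => S) 0
    have h2 : {p : S × S | p.1 = p.2} ∈ uniformity S := by
      rw [DiscreteUniformity.eq_bot (X := S), bot_uniformity]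
      exact fun _ h => h
    exact h1 h2
  refine le_trans ?_ (Dynamics.netEntropyEntourage_le_coverEntropy _ _ hU)
  rw [← ENNReal.log_ofReal_of_pos hlam, ← ExpGrowth.expGrowthSup_pow]
  -- A word of `k + 1` letters has `k` transitions, hence the factor `lam⁻¹`.
  refine ExpGrowth.expGrowthSup_of_eventually_ge (b := ENNReal.ofReal (c * lam⁻¹))
    (ENNReal.ofReal_pos.2 (by positivity)).ne' ?_
  filter_upwards [eventually_gt_atTop 0] with n hn
  obtain ⟨k, rfl⟩ := Nat.exists_eq_succ_of_ne_zero hn.ne'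
  have hex : ∀ w : Fin (k + 1) → S, ∃ x : ℤ → S, w ∈ allowedWords R l r lam k →
      x ∈ pathSpace R ∧ block 0 (k + 1) x = w := by
    intro w
    by_cases hw : w ∈ allowedWords R l r lam k
    · obtain ⟨x, hx⟩ := h.exists_mem_pathSpace 0 hw
      exact ⟨x, fun _ => hx⟩
    · exact ⟨fun _ => w 0, fun hw' => absurd hw' hw⟩
  choose e he using hex
  have hball : ∀ x y : ℤ → S,
      y ∈ UniformSpace.ball x (Dynamics.dynEntourage shift U (k + 1)) →
        block 0 (k + 1) x = block 0 (k + 1) y := by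
    intro x y hxy
    ext i
    have := Dynamics.mem_dynEntourage.1 hxy i i.2
    simpa [hUdef, shift_iterate_apply, block] using this
  have hnet : Dynamics.IsDynNetIn shift (pathSpace R) U (k + 1)
      ((allowedWords R l r lam k).image e : Finset (ℤ → S)) := by
    constructor
    · intro x hx
      obtain ⟨w, hw, rfl⟩ := Finset.mem_image.1 (Finset.mem_coe.1 hx)
      exact (he w hw).1
    · intro x hx y hy hne
      obtain ⟨w, hw, rfl⟩ := Finset.mem_image.1 (Finset.mem_coe.1 hx)
      obtain ⟨v, hv, rfl⟩ := Finset.mem_image.1 (Finset.mem_coe.1 hy)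
      refine Set.disjoint_left.2 fun z hz hz' => hne ?_
      have := (hball _ _ hz).trans (hball _ _ hz').symm
      rw [(he w hw).2, (he v hv).2] at this
      rw [this]
  have hinj : Set.InjOn e (allowedWords R l r lam k) := by
    intro w hw v hv hwv
    rw [← (he w hw).2, ← (he v hv).2, hwv]
  have h1 := hnet.card_le_netMaxcard
  rw [Finset.card_image_of_injOn hinj] at h1
  have h2 := (hcard k).1
  calc ENNReal.ofReal (c * lam⁻¹) * ENNReal.ofReal lam ^ (k + 1)
      = ENNReal.ofReal (c * lam ^ k) := by
        rw [← ENNReal.ofReal_pow hlam.le, ← ENNReal.ofReal_mul (by positivity)]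
        congr 1
        field_simp
        ring
    _ ≤ ENNReal.ofReal ((allowedWords R l r lam k).card : ℝ) := ENNReal.ofReal_le_ofReal h2
    _ = (((allowedWords R l r lam k).card : ℕ∞) : ENNReal) := by simp
    _ ≤ _ := ENat.toENNReal_mono h1

/-- The topological entropy is the logarithm of the Perron eigenvalue. -/
theorem coverEntropy_eq (h : IsPerronData R l r lam) :
    Dynamics.coverEntropy shift (pathSpace R) = (Real.log lam : EReal) :=
  h.coverEntropy_le.antisymm h.le_coverEntropy

end IsPerronData

end TopologicalEntropy

/-! ### The Perron eigenvector of the modified TASEP -/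

section Interpolation

open Polynomial in
/-- Partial fractions for the polynomial `∏ y ∈ S, (q X - y)`. -/
lemma one_add_mul_sum_prod_div {F : Type*} [Field F] [DecidableEq F] (S : Finset F) (h0 : 0 ∉ S)
    {q : F} (hq : q ≠ 0) :
    1 + (q - 1) * ∑ x ∈ S, ∏ y ∈ S.erase x, (q * x - y) / (x - y) = q ^ S.card := by
  set P : F[X] := ∏ y ∈ S, (C q * X + C (-y)) with hP
  have hlead : P.leadingCoeff = q ^ S.card := by
    rw [hP, leadingCoeff_prod]
    simp only [leadingCoeff_linear hq, Finset.prod_const]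
  have hdeg : P.degree = (S.card : WithBot ℕ) := by
    rw [hP, degree_prod]
    simp only [degree_linear hq]
    simp
  have heval : ∀ x, P.eval x = ∏ y ∈ S, (q * x - y) := fun x => by
    simp [hP, eval_prod, sub_eq_add_neg]
  -- The extra node `0` brings the number of nodes to the degree plus one, and it contributes the
  -- summand `1`.
  have key := Lagrange.leadingCoeff_eq_sum (s := insert 0 S) (v := id) (P := P)
    (Set.injOn_id _) (by rw [Finset.card_insert_of_notMem h0, hdeg]; norm_cast)
  rw [hlead, Finset.sum_insert h0, Finset.erase_insert h0] at key
  rw [key]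
  congr 1
  · simp only [id, heval, mul_zero]
    rw [div_self]
    exact Finset.prod_ne_zero_iff.2 fun y hy => sub_ne_zero.2 fun h => h0 (h ▸ hy)
  · rw [Finset.mul_sum]
    refine Finset.sum_congr rfl fun x hx => ?_
    have hx0 : x ≠ 0 := fun h => h0 (h ▸ hx)
    simp only [id, heval]
    rw [Finset.erase_insert_of_ne hx0.symm, Finset.prod_insert (by simp [h0]),
      ← Finset.mul_prod_erase S _ hx, Finset.prod_div_distrib, sub_zero, mul_div_mul_comm,
      show q * x - x = (q - 1) * x by ring, mul_div_cancel_right₀ _ hx0]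

end Interpolation

/-! ### Chords between roots of unity and their products. -/

section Circle

variable {L : ℕ} [NeZero L]

lemma exp_two_mul_sub_one (x : ℂ) :
    Complex.exp (2 * x * Complex.I) - 1 =
      2 * Complex.I * Complex.exp (x * Complex.I) * Complex.sin x := by
  rw [Complex.sin, show 2 * x * Complex.I = x * Complex.I + x * Complex.I by ring, Complex.exp_add,
    show (-x * Complex.I) = -(x * Complex.I) by ring, Complex.exp_neg]
  have := Complex.exp_ne_zero (x * Complex.I)
  have hI : Complex.I * Complex.I = -1 := Complex.I_mul_I
  field_simp
  linear_combination (Complex.exp (x * Complex.I) ^ 2 - 1) * hI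

lemma norm_exp_two_mul_sub_one (x : ℝ) :
    ‖Complex.exp (2 * x * Complex.I) - 1‖ = 2 * |Real.sin x| := by
  rw [exp_two_mul_sub_one]
  simp [Complex.norm_exp_ofReal_mul_I, ← Complex.ofReal_sin]

lemma stdAddChar_intCast_eq (j : ℤ) :
    ZMod.stdAddChar (j : ZMod L) = Complex.exp (2 * ((Real.pi * j / L : ℝ) : ℂ) * Complex.I) := by
  rw [ZMod.stdAddChar_coe]
  congr 1
  push_cast
  ring

lemma norm_stdAddChar (j : ZMod L) : ‖(ZMod.stdAddChar j : ℂ)‖ = 1 := by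
  rw [ZMod.stdAddChar_apply]
  exact Circle.norm_coe _

/-- Moving one step on the circle rotates all chords by the same angle. -/
lemma stdAddChar_add_one_sub_one_mul {k : ZMod L} (hk : k ≠ 0) :
    ((ZMod.stdAddChar (k + 1) : ℂ) - 1) * ‖(ZMod.stdAddChar k : ℂ) - 1‖ =
      Complex.exp (((Real.pi / L : ℝ) : ℂ) * Complex.I) *
        ‖(ZMod.stdAddChar (k + 1) : ℂ) - 1‖ * ((ZMod.stdAddChar k : ℂ) - 1) := by
  have hL : (0 : ℝ) < L := by exact_mod_cast Nat.pos_of_ne_zero (NeZero.ne L)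
  have hm : 0 < k.val := ZMod.val_pos.2 hk
  have hm' : k.val + 1 ≤ L := ZMod.val_lt k
  have hk1 : (ZMod.stdAddChar k : ℂ) =
      Complex.exp (2 * ((Real.pi * ((k.val : ℤ) : ℝ) / L : ℝ) : ℂ) * Complex.I) := by
    rw [← stdAddChar_intCast_eq]
    simp
  have hk2 : (ZMod.stdAddChar (k + 1) : ℂ) =
      Complex.exp (2 * ((Real.pi * ((k.val + 1 : ℤ) : ℝ) / L : ℝ) : ℂ) * Complex.I) := by
    rw [← stdAddChar_intCast_eq]
    simp
  rw [hk1, hk2, norm_exp_two_mul_sub_one, norm_exp_two_mul_sub_one,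
    exp_two_mul_sub_one, exp_two_mul_sub_one]
  have hm1 : (0 : ℝ) ≤ k.val := by positivity
  have hm2 : (k.val : ℝ) + 1 ≤ L := by exact_mod_cast hm'
  have h1 : 0 ≤ Real.sin (Real.pi * ((k.val : ℤ) : ℝ) / L) := by
    refine Real.sin_nonneg_of_nonneg_of_le_pi (by positivity) ?_
    rw [div_le_iff₀ hL]
    push_cast
    exact mul_le_mul_of_nonneg_left (by linarith) Real.pi_pos.le
  have h2 : 0 ≤ Real.sin (Real.pi * ((k.val + 1 : ℤ) : ℝ) / L) := by
    refine Real.sin_nonneg_of_nonneg_of_le_pi (by positivity) ?_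
    rw [div_le_iff₀ hL]
    push_cast
    exact mul_le_mul_of_nonneg_left (by linarith) Real.pi_pos.le
  rw [abs_of_nonneg h1, abs_of_nonneg h2]
  have h3 : ((Real.pi * ((k.val + 1 : ℤ) : ℝ) / L : ℝ) : ℂ) * Complex.I =
      ((Real.pi / L : ℝ) : ℂ) * Complex.I +
        ((Real.pi * ((k.val : ℤ) : ℝ) / L : ℝ) : ℂ) * Complex.I := by
    push_cast
    ring
  rw [h3, Complex.exp_add, ← Complex.ofReal_sin, ← Complex.ofReal_sin]
  push_cast
  ring

/-- The distance between two holes of the circle `ℤ/L`, realized as roots of unity. -/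
def chord (i j : ZMod L) : ℝ := ‖(ZMod.stdAddChar i : ℂ) - ZMod.stdAddChar j‖

lemma chord_comm (i j : ZMod L) : chord i j = chord j i := norm_sub_rev _ _

lemma chord_pos {i j : ZMod L} (h : i ≠ j) : 0 < chord i j :=
  norm_sub_pos_iff.2 fun h' => h (ZMod.injective_stdAddChar h')

lemma chord_self (i : ZMod L) : chord i i = 0 := by simp [chord]

lemma chord_eq (i j : ZMod L) : chord i j = ‖(ZMod.stdAddChar (i - j) : ℂ) - 1‖ := by
  have h : (ZMod.stdAddChar i : ℂ) - ZMod.stdAddChar j =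
      ZMod.stdAddChar j * (ZMod.stdAddChar (i - j) - 1) := by
    rw [mul_sub, ← AddChar.map_add_eq_mul, mul_one, add_sub_cancel]
  rw [chord, h, norm_mul, norm_stdAddChar, one_mul]

lemma chord_neg (i j : ZMod L) : chord (-i) (-j) = chord i j := by
  rw [chord_comm i j, chord_eq, chord_eq, show -i - -j = j - i by ring]

/-- The phase is independent of `i` and `j`; this is what turns the complex interpolation identity
into a real one about chords. -/
lemma div_eq_exp_mul_chord_div {i j : ZMod L} (hij : i ≠ j) :
    ((ZMod.stdAddChar (1 : ZMod L) : ℂ) * ZMod.stdAddChar i - ZMod.stdAddChar j) /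
        (ZMod.stdAddChar i - ZMod.stdAddChar j) =
      Complex.exp (((Real.pi / L : ℝ) : ℂ) * Complex.I) *
        ((chord (i + 1) j / chord i j : ℝ) : ℂ) := by
  have hk : i - j ≠ 0 := sub_ne_zero.2 hij
  have h := stdAddChar_add_one_sub_one_mul hk
  have h1 : (ZMod.stdAddChar i : ℂ) - ZMod.stdAddChar j ≠ 0 :=
    sub_ne_zero.2 fun h' => hij (ZMod.injective_stdAddChar h')
  have h2 : (chord i j : ℂ) ≠ 0 := by exact_mod_cast (chord_pos hij).ne'
  have e1 : (ZMod.stdAddChar i : ℂ) = ZMod.stdAddChar j * ZMod.stdAddChar (i - j) := by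
    rw [← AddChar.map_add_eq_mul, add_sub_cancel]
  have e2 : (ZMod.stdAddChar (1 : ZMod L) : ℂ) * ZMod.stdAddChar i =
      ZMod.stdAddChar j * ZMod.stdAddChar (i - j + 1) := by
    rw [← AddChar.map_add_eq_mul, ← AddChar.map_add_eq_mul]
    congr 1
    ring
  have h3 : ((chord (i + 1) j / chord i j : ℝ) : ℂ) = (chord (i + 1) j : ℂ) / (chord i j : ℂ) :=
    Complex.ofReal_div _ _
  rw [h3, mul_div_assoc', div_eq_div_iff h1 h2, e2, e1, chord_eq, chord_eq,
    show i + 1 - j = i - j + 1 by ring]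
  linear_combination (ZMod.stdAddChar j : ℂ) * h

/-- The trigonometric identity behind the Perron eigenvalue. -/
lemma sum_prod_chord_div (hL : 1 < L) (s : Finset (ZMod L)) :
    ∑ i ∈ s, ∏ j ∈ s.erase i, chord (i + 1) j / chord i j =
      Real.sin (Real.pi * s.card / L) / Real.sin (Real.pi / L) := by
  classical
  rcases s.eq_empty_or_nonempty with rfl | hs
  · simp
  set e : ZMod L → ℂ := fun i => ZMod.stdAddChar i with he
  have hinj : Function.Injective e := ZMod.injective_stdAddChar
  set h : ℂ := Complex.exp (((Real.pi / L : ℝ) : ℂ) * Complex.I) with hh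
  have hh0 : h ≠ 0 := Complex.exp_ne_zero _
  have hL0 : (0 : ℝ) < L := by positivity
  have hsin : 0 < Real.sin (Real.pi / L) := by
    refine Real.sin_pos_of_pos_of_lt_pi (by positivity) ?_
    rw [div_lt_iff₀ hL0]
    have : (1 : ℝ) < L := by exact_mod_cast hL
    nlinarith [Real.pi_pos]
  have hne : ∀ i, e i ≠ 0 := fun i h0 => by
    have := norm_stdAddChar i
    rw [show (ZMod.stdAddChar i : ℂ) = e i from rfl, h0] at this
    simp at this
  have key := one_add_mul_sum_prod_div (s.image e)
    (by simp only [Finset.mem_image, not_exists, not_and]; exact fun i _ => hne i) (hne 1)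
  rw [Finset.card_image_of_injective _ hinj, Finset.sum_image hinj.injOn] at key
  have hterm : ∀ i ∈ s, ∏ y ∈ (s.image e).erase (e i), (e 1 * e i - y) / (e i - y) =
      h ^ (s.card - 1) * ((∏ j ∈ s.erase i, chord (i + 1) j / chord i j : ℝ) : ℂ) := by
    intro i hi
    rw [← Finset.image_erase hinj, Finset.prod_image hinj.injOn,
      Finset.prod_congr rfl fun j hj => div_eq_exp_mul_chord_div (Finset.ne_of_mem_erase hj).symm,
      Finset.prod_mul_distrib, Finset.prod_const, Finset.card_erase_of_mem hi, Complex.ofReal_prod]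
  rw [Finset.sum_congr rfl hterm, ← Finset.mul_sum, ← Complex.ofReal_sum] at key
  have hq1 : e 1 - 1 = 2 * Complex.I * h * (Real.sin (Real.pi / L) : ℝ) := by
    have := stdAddChar_intCast_eq (L := L) 1
    simp only [Int.cast_one, mul_one] at this
    rw [show e 1 = ZMod.stdAddChar (1 : ZMod L) from rfl, this, exp_two_mul_sub_one,
      Complex.ofReal_sin]
  have hqN : e 1 ^ s.card - 1 =
      2 * Complex.I * h ^ s.card * (Real.sin (Real.pi * s.card / L) : ℝ) := by
    have := stdAddChar_intCast_eq (L := L) s.card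
    have h1 : e 1 ^ s.card = ZMod.stdAddChar ((s.card : ℤ) : ZMod L) := by
      simp only [he]
      rw [← AddChar.map_nsmul_eq_pow]
      congr 1
      simp
    have h2 : h ^ s.card = Complex.exp (((Real.pi * ((s.card : ℤ) : ℝ) / L : ℝ) : ℂ) * Complex.I) := by
      rw [hh, ← Complex.exp_nat_mul]
      congr 1
      push_cast
      ring
    rw [h1, this, exp_two_mul_sub_one, h2, Complex.ofReal_sin, Int.cast_natCast]
  set T : ℝ := ∑ i ∈ s, ∏ j ∈ s.erase i, chord (i + 1) j / chord i j
  -- The phase is `h` in `e 1 - 1`, `h ^ (s.card - 1)` in each product and `h ^ s.card` in `e 1 ^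
  -- s.card - 1`; these cancel.
  have hpow : h ^ s.card = h * h ^ (s.card - 1) := by
    rw [← pow_succ', Nat.sub_add_cancel hs.card_pos]
  have h2 : (2 * Complex.I * h * h ^ (s.card - 1)) * ((Real.sin (Real.pi / L) * T : ℝ) : ℂ) =
      (2 * Complex.I * h * h ^ (s.card - 1)) * ((Real.sin (Real.pi * s.card / L) : ℝ) : ℂ) := by
    rw [hq1] at key
    rw [hpow] at hqN
    push_cast at key hqN ⊢
    linear_combination key + hqN
  have h3 := mul_left_cancel₀ (by simp [hh0]) h2
  have h4 : Real.sin (Real.pi / L) * T = Real.sin (Real.pi * s.card / L) := by exact_mod_cast h3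
  rw [eq_div_iff hsin.ne', mul_comm]
  exact h4

/-- The Perron eigenvector: the product of the distances between the stones. -/
def chordProduct (s : Finset (ZMod L)) : ℝ := √(∏ p ∈ s.offDiag, chord p.1 p.2)

lemma prod_offDiag_nonneg (s : Finset (ZMod L)) : 0 ≤ ∏ p ∈ s.offDiag, chord p.1 p.2 :=
  Finset.prod_nonneg fun _ _ => norm_nonneg _

lemma chordProduct_pos (s : Finset (ZMod L)) : 0 < chordProduct s :=
  Real.sqrt_pos.2 (Finset.prod_pos fun _ hp => chord_pos (Finset.mem_offDiag.1 hp).2.2)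

lemma chordProduct_sq (s : Finset (ZMod L)) :
    chordProduct s ^ 2 = ∏ p ∈ s.offDiag, chord p.1 p.2 := Real.sq_sqrt (prod_offDiag_nonneg s)

/-- `offDiag` lists every pair in both orders, which the square root in `chordProduct` undoes. -/
lemma chordProduct_insert {s : Finset (ZMod L)} {i : ZMod L} (hi : i ∉ s) :
    chordProduct (insert i s) = chordProduct s * ∏ j ∈ s, chord i j := by
  have h0 : 0 ≤ ∏ j ∈ s, chord i j := Finset.prod_nonneg fun _ _ => norm_nonneg _
  rw [chordProduct, chordProduct, ← Real.sqrt_sq h0, ← Real.sqrt_mul (prod_offDiag_nonneg s),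
    Finset.offDiag_insert hi]
  congr 1
  rw [Finset.prod_union, Finset.prod_union, Finset.prod_product, Finset.prod_product]
  · simp only [Finset.prod_singleton, chord_comm _ i]
    ring
  · rw [Finset.disjoint_left]
    rintro ⟨a, b⟩ h1 h2
    simp only [Finset.mem_offDiag, Finset.mem_product, Finset.mem_singleton] at h1 h2
    exact hi (h2.1 ▸ h1.1)
  · rw [Finset.disjoint_left]
    rintro ⟨a, b⟩ h1 h2
    simp only [Finset.mem_union, Finset.mem_offDiag, Finset.mem_product,
      Finset.mem_singleton] at h1 h2
    rcases h1 with h1 | h1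
    · exact hi (h2.2 ▸ h1.2.1)
    · exact hi (h1.1 ▸ h2.1)

lemma chordProduct_image_neg (s : Finset (ZMod L)) :
    chordProduct (s.image Neg.neg) = chordProduct s := by
  induction s using Finset.induction_on with
  | empty => rfl
  | insert i s hi ih =>
    rw [Finset.image_insert, chordProduct_insert hi, chordProduct_insert, ih,
      Finset.prod_image neg_injective.injOn]
    · simp [chord_neg]
    · simpa using hi

/-- The sum of the eigenvector over the configurations obtained by moving one stone. -/
lemma sum_chordProduct_move (hL : 1 < L) (s : Finset (ZMod L)) :
    ∑ i ∈ s with i + 1 ∉ s, chordProduct (insert (i + 1) (s.erase i)) =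
      Real.sin (Real.pi * s.card / L) / Real.sin (Real.pi / L) * chordProduct s := by
  rw [← sum_prod_chord_div hL, Finset.sum_mul, Finset.sum_filter]
  refine Finset.sum_congr rfl fun i hi => ?_
  have : Fact (1 < L) := ⟨hL⟩
  have hne : i + 1 ≠ i := by simp
  split_ifs with h
  -- A blocked stone would land on another one: the factor `chord (i + 1) (i + 1)` kills its term.
  · rw [Finset.prod_eq_zero (Finset.mem_erase.2 ⟨hne, h⟩) (by simp [chord_self]), zero_mul]
  · have h1 : i + 1 ∉ s.erase i := fun h' => h (Finset.mem_of_mem_erase h')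
    have h2 : chordProduct s = chordProduct (s.erase i) * ∏ j ∈ s.erase i, chord i j := by
      rw [← chordProduct_insert (Finset.notMem_erase i s), Finset.insert_erase hi]
    have h3 : ∏ j ∈ s.erase i, chord i j ≠ 0 :=
      Finset.prod_ne_zero_iff.2 fun j hj => (chord_pos (Finset.ne_of_mem_erase hj).symm).ne'
    rw [chordProduct_insert h1, h2, Finset.prod_div_distrib]
    field_simp

end Circle

/-! ### The modified TASEP as an irreducible topological Markov chain -/

section Tasep

variable {L N : ℕ} [NeZero L]

instance : Fintype (State L N) := inferInstanceAs (Fintype {s : Finset (ZMod L) // s.card = N})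

instance : MeasurableSingletonClass (State L N) := ⟨fun _ => trivial⟩

instance : DiscreteUniformity (State L N) := ⟨rfl⟩

open scoped Classical in
lemma sum_jump_right (hL : 1 < L) (s : State L N) :
    ∑ t with Jump L N s t, chordProduct t.1 =
      Real.sin (Real.pi * N / L) / Real.sin (Real.pi / L) * chordProduct s.1 := by
  have : Fact (1 < L) := ⟨hL⟩
  have hmove := sum_chordProduct_move hL s.1
  rw [s.2] at hmove
  rw [← hmove]
  symm
  have hcard : ∀ i ∈ s.1.filter fun i => i + 1 ∉ s.1,
      (insert (i + 1) (s.1.erase i)).card = N := by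
    intro i hi
    obtain ⟨h1, h2⟩ := Finset.mem_filter.1 hi
    rw [Finset.card_insert_of_notMem fun h => h2 (Finset.mem_of_mem_erase h),
      Finset.card_erase_add_one h1, s.2]
  refine Finset.sum_bij (fun i hi => (⟨insert (i + 1) (s.1.erase i), hcard i hi⟩ : State L N))
    ?_ ?_ ?_ ?_
  · intro i hi
    obtain ⟨h1, h2⟩ := Finset.mem_filter.1 hi
    exact Finset.mem_filter.2 ⟨Finset.mem_univ _, i, h1, h2, rfl⟩
  · intro i hi j hj hij
    have hij' := congrArg Subtype.val hij
    simp only at hij'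
    by_contra hne
    have h1 : i ∈ insert (j + 1) (s.1.erase j) :=
      Finset.mem_insert_of_mem (Finset.mem_erase.2 ⟨hne, (Finset.mem_filter.1 hi).1⟩)
    rw [← hij', Finset.mem_insert] at h1
    rcases h1 with h1 | h1
    · exact (show i ≠ i + 1 by simp) h1
    · exact Finset.notMem_erase i s.1 h1
  · intro t ht
    obtain ⟨i, h1, h2, h3⟩ := (Finset.mem_filter.1 ht).2
    exact ⟨i, Finset.mem_filter.2 ⟨h1, h2⟩, Subtype.ext h3.symm⟩
  · intro i hi
    rfl

/-- Reflection of the circle. -/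
def State.reflect (s : State L N) : State L N :=
  ⟨s.1.image Neg.neg, by rw [Finset.card_image_of_injective _ neg_injective, s.2]⟩

lemma State.mem_reflect {s : State L N} {i : ZMod L} : i ∈ s.reflect.1 ↔ -i ∈ s.1 := by
  simp only [State.reflect, Finset.mem_image]
  exact ⟨fun ⟨j, hj, h⟩ => by rwa [← h, neg_neg], fun h => ⟨-i, h, neg_neg i⟩⟩

lemma State.reflect_reflect (s : State L N) : s.reflect.reflect = s := by
  refine Subtype.ext (Finset.ext fun i => ?_)
  rw [State.mem_reflect, State.mem_reflect, neg_neg]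

/-- Reflection conjugates the jump relation to its inverse, so a reflection-invariant right
eigenvector is also a left one. -/
lemma jump_reflect (hL : 1 < L) {s t : State L N} (h : Jump L N s t) :
    Jump L N t.reflect s.reflect := by
  have : Fact (1 < L) := ⟨hL⟩
  obtain ⟨i, hi, hi', ht⟩ := h
  have hne : i ≠ i + 1 := by simp
  refine ⟨-(i + 1), ?_, ?_, ?_⟩
  · rw [State.mem_reflect, neg_neg, ht]
    exact Finset.mem_insert_self _ _
  · rw [State.mem_reflect, ht, show -(-(i + 1) + 1) = i by ring]
    simp
  · ext k
    rw [State.mem_reflect, Finset.mem_insert, Finset.mem_erase, State.mem_reflect, ht,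
      Finset.mem_insert, Finset.mem_erase, show -(i + 1) + 1 = -i by ring]
    have h1 : k = -i ↔ -k = i := neg_eq_iff_eq_neg.symm
    have h2 : k ≠ -(i + 1) ↔ -k ≠ i + 1 := not_congr neg_eq_iff_eq_neg.symm
    rw [h1, h2]
    constructor
    · intro hk
      by_cases hki : -k = i
      · exact Or.inl hki
      · exact Or.inr ⟨fun h => hi' (h ▸ hk), Or.inr ⟨hki, hk⟩⟩
    · rintro (hk | ⟨h3, h4 | h4⟩)
      · rwa [hk]
      · exact absurd h4 h3
      · exact h4.2

open scoped Classical in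
lemma sum_jump_left (hL : 1 < L) (t : State L N) :
    ∑ s with Jump L N s t, chordProduct s.1 =
      Real.sin (Real.pi * N / L) / Real.sin (Real.pi / L) * chordProduct t.1 := by
  have h := sum_jump_right hL t.reflect
  rw [show chordProduct t.reflect.1 = chordProduct t.1 from chordProduct_image_neg _] at h
  rw [← h]
  refine Finset.sum_bij (fun s _ => s.reflect) ?_ ?_ ?_ ?_
  · intro s hs
    exact Finset.mem_filter.2 ⟨Finset.mem_univ _, jump_reflect hL (Finset.mem_filter.1 hs).2⟩
  · intro s _ s' _ hss'
    rw [← s.reflect_reflect, hss', State.reflect_reflect]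
  · intro s hs
    refine ⟨s.reflect, Finset.mem_filter.2 ⟨Finset.mem_univ _, ?_⟩, s.reflect_reflect⟩
    have := jump_reflect hL (Finset.mem_filter.1 hs).2
    rwa [State.reflect_reflect] at this
  · intro s _
    exact (chordProduct_image_neg s.1).symm

/-- The configuration in which the stones occupy the holes `0, …, N - 1`. -/
def packedState (hNL : N < L) : State L N :=
  ⟨(Finset.range N).image fun n : ℕ => (n : ZMod L), by
    rw [Finset.card_image_of_injOn, Finset.card_range]
    intro a ha b hb hab
    have ha' : a < L := (Finset.mem_range.1 ha).trans hNL
    have hb' : b < L := (Finset.mem_range.1 hb).trans hNL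
    rw [← ZMod.val_cast_of_lt ha', ← ZMod.val_cast_of_lt hb']
    exact congrArg ZMod.val hab⟩

/-- If no stone away from `0` can step back, the occupied set is closed downwards and so is an
initial segment. -/
lemma eq_packedState_of_forall (hNL : N < L) {t : State L N}
    (h : ∀ i ∈ t.1, i ≠ 0 → i - 1 ∈ t.1) : t = packedState hNL := by
  have hdown : ∀ (d m : ℕ), m + d < L → ((m + d : ℕ) : ZMod L) ∈ t.1 → (m : ZMod L) ∈ t.1 := by
    intro d
    induction d with
    | zero => exact fun m _ h => h
    | succ d ih =>
      intro m hm hmem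
      refine ih m (by omega) ?_
      have hne : ((m + (d + 1) : ℕ) : ZMod L) ≠ 0 := by
        rw [Ne, ZMod.natCast_eq_zero_iff]
        exact fun hdvd => absurd (Nat.le_of_dvd (by omega) hdvd) (by omega)
      have := h _ hmem hne
      rwa [show ((m + (d + 1) : ℕ) : ZMod L) - 1 = ((m + d : ℕ) : ZMod L) by push_cast; ring] at this
  refine Subtype.ext (Finset.eq_of_subset_of_card_le (fun i hi => ?_) ?_)
  · have hsub : (Finset.range (i.val + 1)).image (fun n : ℕ => (n : ZMod L)) ⊆ t.1 := by
      intro j hj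
      obtain ⟨m, hm, rfl⟩ := Finset.mem_image.1 hj
      have hm' := Finset.mem_range.1 hm
      have hiL := ZMod.val_lt i
      refine hdown (i.val - m) m (by omega) ?_
      rwa [show m + (i.val - m) = i.val by omega, ZMod.natCast_zmod_val]
    have hcard := Finset.card_le_card hsub
    rw [t.2, Finset.card_image_of_injOn, Finset.card_range] at hcard
    · exact Finset.mem_image.2 ⟨i.val, Finset.mem_range.2 hcard, ZMod.natCast_zmod_val i⟩
    · intro a ha b hb hab
      have hiL := ZMod.val_lt i
      have ha' : a < L := by have := Finset.mem_range.1 ha; omega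
      have hb' : b < L := by have := Finset.mem_range.1 hb; omega
      rw [← ZMod.val_cast_of_lt ha', ← ZMod.val_cast_of_lt hb']
      exact congrArg ZMod.val hab
  · rw [t.2, (packedState hNL).2]

/-- Pulling back a stone from `i ≠ 0` lowers the sum of the positions in `0, …, L - 1`, so repeated
pulling ends at the packed state. -/
lemma reflTransGen_packedState (hNL : N < L) (t : State L N) :
    Relation.ReflTransGen (Jump L N) (packedState hNL) t := by
  induction hk : ∑ i ∈ t.1, i.val using Nat.strong_induction_on generalizing t with
  | _ k ih =>
    by_cases hall : ∀ i ∈ t.1, i ≠ 0 → i - 1 ∈ t.1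
    · rw [eq_packedState_of_forall hNL hall]
    · push Not at hall
      obtain ⟨i, hi, hi0, hi1⟩ := hall
      have hi1' : i - 1 ∉ t.1.erase i := fun h => hi1 (Finset.mem_of_mem_erase h)
      have hne : i - 1 ≠ i := fun h => hi1 (h.symm ▸ hi)
      have hcard : (insert (i - 1) (t.1.erase i)).card = N := by
        rw [Finset.card_insert_of_notMem hi1', Finset.card_erase_add_one hi, t.2]
      have hval : (i - 1).val < i.val := by
        have hpos := ZMod.val_pos.2 hi0
        have hlt := ZMod.val_lt i
        have : i - 1 = ((i.val - 1 : ℕ) : ZMod L) := by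
          rw [Nat.cast_sub hpos, ZMod.natCast_zmod_val, Nat.cast_one]
        rw [this, ZMod.val_cast_of_lt (by omega)]
        omega
      refine (ih _ ?_ ⟨insert (i - 1) (t.1.erase i), hcard⟩ rfl).tail ?_
      · rw [← hk, Finset.sum_insert hi1', ← Finset.add_sum_erase _ _ hi]
        exact Nat.add_lt_add_right hval _
      · refine ⟨i - 1, Finset.mem_insert_self _ _, ?_, ?_⟩
        · rw [sub_add_cancel]
          simp [hne.symm]
        · rw [sub_add_cancel]
          simp only
          rw [Finset.erase_insert hi1', Finset.insert_erase hi]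

/-- The partition function of the modified TASEP. -/
def partitionFunction (L N : ℕ) [NeZero L] : ℝ := ∑ s : State L N, chordProduct s.1 ^ 2

lemma isPerronData (hN : 0 < N) (hNL : N < L) :
    IsPerronData (Jump L N) (fun s => chordProduct s.1 / partitionFunction L N)
      (fun s => chordProduct s.1) (Real.sin (Real.pi * N / L) / Real.sin (Real.pi / L)) := by
  have hL : 1 < L := by omega
  have hL0 : (0 : ℝ) < L := by positivity
  have hZ : 0 < partitionFunction L N :=
    Finset.sum_pos (fun s _ => pow_pos (chordProduct_pos s.1) 2) ⟨packedState hNL, Finset.mem_univ _⟩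
  have hsin : ∀ n : ℕ, 0 < n → n < L → 0 < Real.sin (Real.pi * n / L) := by
    intro n hn hnL
    have h1 : (0 : ℝ) < n := by exact_mod_cast hn
    have h2 : (n : ℝ) < L := by exact_mod_cast hnL
    refine Real.sin_pos_of_pos_of_lt_pi (by positivity) ?_
    rw [div_lt_iff₀ hL0]
    exact mul_lt_mul_of_pos_left h2 Real.pi_pos
  have hsin1 : 0 < Real.sin (Real.pi / L) := by simpa using hsin 1 one_pos hL
  refine ⟨fun s => div_pos (chordProduct_pos _) hZ, fun s => chordProduct_pos _,
    div_pos (hsin N hN hNL) hsin1, fun t => ?_, fun s => sum_jump_right hL s, ?_,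
    packedState hNL, reflTransGen_packedState hNL⟩
  · rw [← Finset.sum_div, sum_jump_left hL t, mul_div_assoc]
  · rw [← div_self hZ.ne']
    conv_rhs => rw [partitionFunction, Finset.sum_div]
    exact Finset.sum_congr rfl fun s _ => by rw [partitionFunction]; ring

end Tasep

/-! ### Principal minors of projections -/

section Minors

open Matrix

variable {F : Type*} [Field F] {V : Type*} [Fintype V] [DecidableEq V]

/-- A block triangular factor built from the adjugate clears the upper right block without inverting
`M`, at the price of a spare factor `M.det`. -/
lemma det_fromBlocks_unit_mul {R : Type*} [CommRing R] {m : Type*} [Fintype m] [DecidableEq m]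
    (M : Matrix m m R) (B : Matrix m Unit R) (C : Matrix Unit m R) (D : Matrix Unit Unit R) :
    (fromBlocks M B C D).det * M.det =
      M.det * (D () () * M.det - (C * M.adjugate * B) () ()) := by
  have h : fromBlocks M B C D * fromBlocks 1 (-(M.adjugate * B)) 0 (M.det • (1 : Matrix Unit Unit R)) =
      fromBlocks M 0 C (M.det • D - C * M.adjugate * B) := by
    rw [fromBlocks_multiply]
    congr 1
    · simp
    · rw [Matrix.mul_neg, ← Matrix.mul_assoc, mul_adjugate, Matrix.smul_mul, Matrix.one_mul,
        Matrix.mul_smul, Matrix.mul_one, neg_add_cancel]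
    · simp
    · rw [Matrix.mul_neg, ← Matrix.mul_assoc, Matrix.mul_smul, Matrix.mul_one]
      abel
  have h2 := congrArg Matrix.det h
  rw [det_mul, det_fromBlocks_zero₂₁, det_fromBlocks_zero₁₂, det_one, one_mul] at h2
  simp only [det_unique, PUnit.default_eq_unit, Matrix.smul_apply, one_apply_eq, smul_eq_mul, mul_one,
    Matrix.sub_apply] at h2
  rw [h2]
  ring

/-- The determinant of a matrix bordered by one row and one column. -/
lemma det_fromBlocks_unit {m : Type*} [Fintype m] [DecidableEq m]
    (M : Matrix m m F) (B : Matrix m Unit F) (C : Matrix Unit m F) (D : Matrix Unit Unit F) :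
    (fromBlocks M B C D).det = D () () * M.det - (C * M.adjugate * B) () () := by
  -- Since `M.det` may vanish, `M` is deformed to `X + M = charmatrix (-M)`, whose determinant is
  -- monic and can be cancelled; evaluation at `0` recovers `M`.
  set φ : Polynomial F →+* F := Polynomial.evalRingHom 0
  set ι : F →+* Polynomial F := Polynomial.C
  have hM : (charmatrix (-M)).map φ = M := by
    ext i j
    by_cases hij : i = j
    · subst hij
      simp [φ, charmatrix_apply_eq]
    · simp [φ, charmatrix_apply_ne _ _ _ hij]
  have hφι : ∀ c, φ (ι c) = c := fun c => Polynomial.eval_C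
  have hB : (B.map ι).map φ = B := Matrix.ext fun i j => hφι _
  have hC : (C.map ι).map φ = C := Matrix.ext fun i j => hφι _
  have hD : (D.map ι).map φ = D := Matrix.ext fun i j => hφι _
  have h := det_fromBlocks_unit_mul (charmatrix (-M)) (B.map ι) (C.map ι) (D.map ι)
  rw [mul_comm] at h
  have h2 := congrArg φ (mul_left_cancel₀ (charpoly_monic (-M)).ne_zero h)
  rw [map_sub, map_mul, RingHom.map_det, RingHom.map_det, RingHom.mapMatrix_apply,
    RingHom.mapMatrix_apply, fromBlocks_map, hM, hB, hC, hD] at h2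
  have h3 : φ ((C.map ι * (charmatrix (-M)).adjugate * B.map ι) () ()) =
      (C * M.adjugate * B) () () := by
    have h4 : (C.map ι * (charmatrix (-M)).adjugate * B.map ι).map φ = C * M.adjugate * B := by
      rw [Matrix.map_mul, Matrix.map_mul]
      have h5 := RingHom.map_adjugate φ (charmatrix (-M))
      rw [RingHom.mapMatrix_apply, RingHom.mapMatrix_apply, hM] at h5
      rw [h5, hB, hC]
    rw [← h4]
    rfl
  rwa [h3, Matrix.map_apply, hφι] at h2

/-- The principal minor of `K` with rows and columns in `A`. -/
def principalMinor (K : Matrix V V F) (A : Finset V) : F :=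
  (K.submatrix (Subtype.val : A → V) (Subtype.val : A → V)).det

lemma principalMinor_empty (K : Matrix V V F) : principalMinor K ∅ = 1 := det_isEmpty

lemma det_submatrix_sumElim (K : Matrix V V F) (A : Finset V) (x : V) :
    (K.submatrix (Sum.elim Subtype.val fun _ : Unit => x)
      (Sum.elim (Subtype.val : A → V) fun _ : Unit => x)).det =
      if x ∈ A then 0 else principalMinor K (insert x A) := by
  split_ifs with hx
  · exact det_zero_of_row_eq (i := Sum.inl ⟨x, hx⟩) (j := Sum.inr ()) (by simp) rfl
  · set f : A ⊕ Unit → V := Sum.elim Subtype.val fun _ => x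
    have hf : ∀ y, f y ∈ insert x A := by
      rintro (⟨a, ha⟩ | _)
      · exact Finset.mem_insert_of_mem ha
      · exact Finset.mem_insert_self x A
    have hbij : Function.Bijective fun y => (⟨f y, hf y⟩ : (insert x A : Finset V)) := by
      constructor
      · rintro (⟨a, ha⟩ | _) (⟨b, hb⟩ | _) hab <;> simp only [Subtype.mk.injEq] at hab
        · simp only [f, Sum.elim_inl] at hab
          subst hab
          rfl
        · exact absurd (show x ∈ A from (show a = x from hab) ▸ ha) hx
        · exact absurd (show x ∈ A from (show x = b from hab) ▸ hb) hx
        · rfl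
      · rintro ⟨y, hy⟩
        rcases Finset.mem_insert.1 hy with rfl | hy'
        · exact ⟨Sum.inr (), rfl⟩
        · exact ⟨Sum.inl ⟨y, hy'⟩, rfl⟩
    rw [principalMinor, ← det_submatrix_equiv_self (Equiv.ofBijective _ hbij)]
    rfl

/-- Summing the one-point extensions of a principal minor of an idempotent matrix. -/
lemma sum_principalMinor_insert {K : Matrix V V F} (hK : K * K = K) (A : Finset V) :
    ∑ x ∈ Finset.univ \ A, principalMinor K (insert x A) =
      (K.trace - A.card) * principalMinor K A := by
  set M := K.submatrix (Subtype.val : A → V) (Subtype.val : A → V) with hM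
  have hD : ∀ x, (if x ∈ A then 0 else principalMinor K (insert x A)) =
      K x x * M.det - ∑ b : A, ∑ a : A, K x a * M.adjugate a b * K b x := by
    intro x
    rw [← det_submatrix_sumElim]
    have h : K.submatrix (Sum.elim (Subtype.val : A → V) fun _ : Unit => x)
        (Sum.elim (Subtype.val : A → V) fun _ : Unit => x) =
        fromBlocks M (Matrix.of fun a _ => K a x) (Matrix.of fun _ a => K x a)
          (Matrix.of fun _ _ => K x x) := by
      ext (i | i) (j | j) <;> rfl
    rw [h, det_fromBlocks_unit]
    simp only [Matrix.mul_apply, of_apply, Finset.sum_mul]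
  have hsum : ∑ x ∈ Finset.univ \ A, principalMinor K (insert x A) =
      ∑ x, if x ∈ A then 0 else principalMinor K (insert x A) := by
    rw [← Finset.sum_filter_add_sum_filter_not Finset.univ (· ∈ A)]
    rw [Finset.sum_congr rfl (fun x hx => if_pos (Finset.mem_filter.1 hx).2), Finset.sum_const_zero,
      zero_add]
    refine Finset.sum_congr (by ext; simp) fun x hx => ?_
    rw [if_neg (Finset.mem_filter.1 hx).2]
  -- Summing over `x` first contracts `K b x * K x a` to `K b a` by idempotence, leaving the trace
  -- of `M.adjugate * M`.
  have hadj : ∑ x, ∑ b : A, ∑ a : A, K x a * M.adjugate a b * K b x = A.card * M.det := by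
    have h1 : ∀ a b : A, ∑ x, K x a * M.adjugate a b * K b x = M.adjugate a b * M b a := by
      intro a b
      have h2 := congrFun (congrFun hK b) a
      rw [Matrix.mul_apply] at h2
      rw [hM, submatrix_apply, ← h2, Finset.mul_sum]
      exact Finset.sum_congr rfl fun x _ => by ring
    rw [Finset.sum_comm]
    simp_rw [Finset.sum_comm (s := (Finset.univ : Finset V)), h1]
    rw [Finset.sum_comm]
    have h3 : (M.adjugate * M).trace = A.card * M.det := by
      rw [adjugate_mul, trace_smul, trace_one, Fintype.card_coe, smul_eq_mul, mul_comm]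
    rw [← h3, trace]
    simp only [diag_apply, Matrix.mul_apply]
  rw [hsum, Finset.sum_congr rfl fun x _ => hD x, Finset.sum_sub_distrib, ← Finset.sum_mul, hadj,
    principalMinor, ← hM, trace]
  simp only [diag_apply]
  ring

/-- For a projection of rank `n`, the principal minors of size `n` containing `A` add up to the
principal minor of `A`. -/
theorem sum_principalMinor_eq [CharZero F] {ι : Type*} [Fintype ι] [DecidableEq ι]
    {X : Matrix V ι F} {Y : Matrix ι V F} (hYX : Y * X = 1) (A : Finset V) :
    ∑ s ∈ Finset.powersetCard (Fintype.card ι) Finset.univ with A ⊆ s, principalMinor (X * Y) s =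
      principalMinor (X * Y) A := by
  set K := X * Y with hKdef
  have hK : K * K = K := by
    rw [hKdef, Matrix.mul_assoc, ← Matrix.mul_assoc Y, hYX, Matrix.one_mul]
  have htr : K.trace = Fintype.card ι := by
    rw [hKdef, trace_mul_comm, hYX, trace_one]
  -- Above the rank both sides vanish. Otherwise `A` is enlarged point by point: each `s ⊇ A` arises
  -- once per element of `s \ A`, and this multiplicity is the factor in
  -- `sum_principalMinor_insert`, cancelled in characteristic zero.
  rcases lt_or_ge (Fintype.card ι) A.card with hA | hA
  · have h0 : principalMinor K A = 0 := by
      by_contra hne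
      have h1 : (K.submatrix (Subtype.val : A → V) (Subtype.val : A → V)) =
          X.submatrix (Subtype.val : A → V) id * Y.submatrix id (Subtype.val : A → V) := by
        rw [hKdef, submatrix_mul _ _ _ id _ Function.bijective_id]
      have h2 := rank_of_isUnit _ ((isUnit_iff_isUnit_det _).2 (isUnit_iff_ne_zero.2 hne))
      rw [h1, Fintype.card_coe] at h2
      have h3 := (rank_mul_le_left (X.submatrix (Subtype.val : A → V) id)
        (Y.submatrix id (Subtype.val : A → V))).trans (rank_le_card_width _)
      omega
    rw [h0]
    refine Finset.sum_eq_zero fun s hs => ?_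
    obtain ⟨h1, h2⟩ := Finset.mem_filter.1 hs
    have h3 := Finset.card_le_card h2
    have h4 := (Finset.mem_powersetCard.1 h1).2
    omega
  · induction hd : Fintype.card ι - A.card generalizing A with
    | zero =>
      have hcard : A.card = Fintype.card ι := by omega
      rw [Finset.sum_eq_single A]
      · intro s hs hne
        obtain ⟨h1, h2⟩ := Finset.mem_filter.1 hs
        exact absurd (Finset.eq_of_subset_of_card_le h2
          (by rw [(Finset.mem_powersetCard.1 h1).2, hcard])).symm hne
      · intro h
        exact absurd (Finset.mem_filter.2 ⟨Finset.mem_powersetCard.2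
          ⟨Finset.subset_univ _, hcard⟩, Finset.Subset.refl A⟩) h
    | succ d ih =>
      have hne : ((Fintype.card ι : F) - A.card) ≠ 0 :=
        sub_ne_zero.2 (by exact_mod_cast (show Fintype.card ι ≠ A.card by omega))
      refine mul_left_cancel₀ hne ?_
      rw [← htr, ← sum_principalMinor_insert hK A, htr]
      have hih : ∀ x ∈ Finset.univ \ A, principalMinor K (insert x A) =
          ∑ s ∈ Finset.powersetCard (Fintype.card ι) Finset.univ,
            if insert x A ⊆ s then principalMinor K s else 0 := by
        intro x hx
        have hcard := Finset.card_insert_of_notMem (Finset.mem_sdiff.1 hx).2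
        rw [← ih (insert x A) (by omega) (by omega), Finset.sum_filter]
      rw [Finset.sum_congr rfl hih, Finset.sum_comm, Finset.mul_sum, Finset.sum_filter]
      refine Finset.sum_congr rfl fun s hs => ?_
      have hs' := (Finset.mem_powersetCard.1 hs).2
      split_ifs with hAs
      · rw [← Finset.sum_filter, Finset.sum_const, nsmul_eq_mul]
        congr 1
        have : (Finset.univ \ A).filter (fun x => insert x A ⊆ s) = s \ A := by
          ext x
          simp only [Finset.mem_filter, Finset.mem_sdiff, Finset.mem_univ, true_and,
            Finset.insert_subset_iff]
          tauto
        rw [this, Finset.card_sdiff_of_subset hAs, Nat.cast_sub (Finset.card_le_card hAs), hs']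
      · exact (Finset.sum_eq_zero fun x _ => if_neg fun h =>
          hAs ((Finset.subset_insert x A).trans h)).symm

end Minors

/-! ### The Fourier kernel -/

section Fourier

open Matrix

variable {L N : ℕ} [NeZero L]

lemma harmonic_apply (r : ℤ) (j : ZMod L) :
    harmonic L r j = ZMod.stdAddChar (-(r : ZMod L) * j) := by
  have h : -(r : ZMod L) * j = ((-r * (j.val : ℤ) : ℤ) : ZMod L) := by simp
  rw [h, ZMod.stdAddChar_coe, harmonic]
  simp only
  congr 1
  push_cast
  ring

lemma star_stdAddChar (j : ZMod L) :
    star (ZMod.stdAddChar j : ℂ) = ZMod.stdAddChar (-j) := by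
  rw [AddChar.map_neg_eq_conj]
  rfl

lemma sum_star_harmonic_mul (r r' : ℤ) :
    ∑ j, star (harmonic L r j) * harmonic L r' j = if (r : ZMod L) = (r' : ZMod L) then (L : ℂ) else 0 := by
  have h : ∀ j, star (harmonic L r j) * harmonic L r' j =
      (ZMod.stdAddChar (j * ((r : ZMod L) - (r' : ZMod L))) : ℂ) := fun j => by
    rw [harmonic_apply, harmonic_apply, star_stdAddChar, ← AddChar.map_add_eq_mul]
    congr 1
    ring
  rw [Finset.sum_congr rfl fun j _ => h j,
    AddChar.sum_mulShift _ (ZMod.isPrimitive_stdAddChar L)]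
  simp [sub_eq_zero, ZMod.card]

variable (L N) in
/-- The matrix whose columns are the harmonics with indices `a, …, a + N - 1`. -/
def harmonicMatrix (a : ℤ) : Matrix (ZMod L) (Fin N) ℂ :=
  Matrix.of fun j r => harmonic L (a + (r : ℕ)) j

/-- Orthogonality of characters; `N ≤ L` keeps the consecutive frequencies distinct modulo `L`. -/
lemma conjTranspose_mul_harmonicMatrix (hNL : N ≤ L) (a : ℤ) :
    ((L : ℂ)⁻¹ • (harmonicMatrix L N a)ᴴ) * harmonicMatrix L N a = 1 := by
  have hL : (L : ℂ) ≠ 0 := by exact_mod_cast NeZero.ne L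
  ext r r'
  rw [Matrix.smul_mul, Matrix.smul_apply, Matrix.mul_apply]
  simp only [conjTranspose_apply, harmonicMatrix, of_apply]
  rw [sum_star_harmonic_mul]
  have h : (((a + (r : ℕ) : ℤ) : ZMod L) = ((a + (r' : ℕ) : ℤ) : ZMod L)) ↔ r = r' := by
    constructor
    · intro h
      push_cast at h
      have h1 := congrArg ZMod.val (add_left_cancel h)
      rw [ZMod.val_cast_of_lt (r.2.trans_le hNL), ZMod.val_cast_of_lt (r'.2.trans_le hNL)] at h1
      exact Fin.ext h1
    · rintro rfl
      rfl
  rw [Matrix.one_apply]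
  by_cases hr : r = r'
  · rw [if_pos (h.2 hr), if_pos hr, smul_eq_mul, inv_mul_cancel₀ hL]
  · rw [if_neg fun h' => hr (h.1 h'), if_neg hr, smul_zero]

/-- The orthogonal projection onto the span of consecutive harmonics, in coordinates. -/
lemma harmonicKernel_eq (hNL : N ≤ L) (a : ℤ) :
    harmonicKernel L N a = harmonicMatrix L N a * ((L : ℂ)⁻¹ • (harmonicMatrix L N a)ᴴ) := by
  set X := harmonicMatrix L N a with hX
  set Y := (L : ℂ)⁻¹ • Xᴴ with hY
  have hL : (L : ℂ) ≠ 0 := by exact_mod_cast NeZero.ne L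
  have hYX : Y * X = 1 := conjTranspose_mul_harmonicMatrix hNL a
  ext j k
  set w : EuclideanSpace ℂ (ZMod L) := ∑ r : Fin N, Y r k • harmonic L (a + (r : ℕ)) with hw
  have hwapp : ∀ i, w i = (X * Y) i k := by
    intro i
    rw [hw, Matrix.mul_apply]
    simp only [WithLp.ofLp_sum, WithLp.ofLp_smul, Finset.sum_apply, Pi.smul_apply, smul_eq_mul]
    exact Finset.sum_congr rfl fun r _ => mul_comm _ _
  have hmem : w ∈ harmonicSpan L N a := by
    refine Submodule.sum_mem _ fun r _ => Submodule.smul_mem _ _ (Submodule.subset_span ?_)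
    refine ⟨a + (r : ℕ), ⟨by omega, ?_⟩, rfl⟩
    have := r.2
    omega
  -- `X * Y` is self-adjoint and fixes the columns of `X`, so the residual is orthogonal to every
  -- harmonic in the span.
  have horth : ∀ v ∈ harmonicSpan L N a, inner ℂ (EuclideanSpace.single k 1 - w) v = 0 := by
    intro v hv
    refine Submodule.span_induction ?_ (inner_zero_right _) (fun x y _ _ hx hy => ?_)
      (fun c x _ hx => ?_) hv
    · rintro _ ⟨r, hr, rfl⟩
      obtain ⟨m, hm⟩ : ∃ m : ℕ, r = a + m := ⟨(r - a).toNat, by have := hr.1; omega⟩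
      have hmN : m < N := by have := hr.2; omega
      have hm' : r = a + ((⟨m, hmN⟩ : Fin N) : ℕ) := hm
      set q : Fin N := ⟨m, hmN⟩
      rw [inner_sub_left, sub_eq_zero, EuclideanSpace.inner_single_left, map_one, one_mul,
        PiLp.inner_apply]
      have h1 : ∀ i, inner ℂ (w i) (harmonic L r i) = star ((X * Y) i k) * X i q := fun i => by
        rw [hwapp, hX, harmonicMatrix, of_apply, ← hm']
        simp [mul_comm]
      rw [Finset.sum_congr rfl fun i _ => h1 i]
      have h2 : (X * Y)ᴴ = X * Y := by
        rw [hY, Matrix.mul_smul, conjTranspose_smul, conjTranspose_mul, conjTranspose_conjTranspose]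
        simp
      have h3 : ∀ i, star ((X * Y) i k) = (X * Y) k i := fun i => by
        conv_rhs => rw [← h2]
        rfl
      simp only [h3]
      rw [← Matrix.mul_apply, Matrix.mul_assoc, hYX, Matrix.mul_one, hX, harmonicMatrix, of_apply,
        ← hm']
    · rw [inner_add_right, hx, hy, add_zero]
    · rw [inner_smul_right, hx, mul_zero]
  have := Submodule.eq_starProjection_of_mem_of_inner_eq_zero hmem horth
  rw [harmonicKernel, of_apply, this, hwapp]

lemma prod_offDiag_eq_prod_Ioi_sq {n : ℕ} (f : Fin n → Fin n → ℝ) (hf : ∀ i j, f i j = f j i) :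
    ∏ p ∈ (Finset.univ : Finset (Fin n)).offDiag, f p.1 p.2 =
      (∏ i, ∏ j ∈ Finset.Ioi i, f i j) ^ 2 := by
  have h1 : ∏ p ∈ (Finset.univ : Finset (Fin n)).offDiag, f p.1 p.2 =
      ∏ i, ∏ j, ((if i < j then f i j else 1) * if j < i then f i j else 1) := by
    rw [← Fintype.prod_prod_type', Finset.prod_congr
      (show (Finset.univ : Finset (Fin n)).offDiag = Finset.univ.filter fun p => p.1 ≠ p.2 by
        ext; simp) fun _ _ => rfl, Finset.prod_filter]
    refine Finset.prod_congr rfl fun p _ => ?_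
    rcases lt_trichotomy p.1 p.2 with h | h | h
    · simp [h, h.ne, h.not_gt]
    · simp [h]
    · simp [h, h.ne', h.not_gt]
  have h2 : ∏ i, ∏ j, (if i < j then f i j else 1) = ∏ i, ∏ j ∈ Finset.Ioi i, f i j := by
    refine Finset.prod_congr rfl fun i _ => ?_
    rw [← Finset.prod_filter]
    exact Finset.prod_congr (by ext; simp) fun _ _ => rfl
  have h3 : ∏ i, ∏ j, (if j < i then f i j else 1) = ∏ i, ∏ j ∈ Finset.Ioi i, f i j := by
    rw [Finset.prod_comm, ← h2]
    exact Finset.prod_congr rfl fun i _ => Finset.prod_congr rfl fun j _ => by rw [hf]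
  rw [h1]
  simp only [Finset.prod_mul_distrib]
  rw [h2, h3, sq]

/-- The top-dimensional minors of the Fourier kernel are the squared Perron weights. -/
lemma principalMinor_harmonicKernel (hNL : N ≤ L) (a : ℤ) {s : Finset (ZMod L)} (hs : s.card = N) :
    principalMinor (harmonicKernel L N a) s =
      (((L : ℝ)⁻¹ ^ N * chordProduct s ^ 2 : ℝ) : ℂ) := by
  set e : Fin N ≃ s := (s.equivFinOfCardEq hs).symm with he
  set x : Fin N → ZMod L := fun i => e i with hx
  have hxinj : Function.Injective x := Subtype.val_injective.comp e.injective
  set W : Matrix (Fin N) (Fin N) ℂ := (harmonicMatrix L N a).submatrix x id with hW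
  have h1 : principalMinor (harmonicKernel L N a) s = (W * ((L : ℂ)⁻¹ • Wᴴ)).det := by
    rw [principalMinor, ← det_submatrix_equiv_self e, submatrix_submatrix, harmonicKernel_eq hNL]
    congr 1
  have h2 : ‖W.det‖ = ∏ i, ∏ j ∈ Finset.Ioi i, chord (x i) (x j) := by
    -- Consecutive frequencies make each row a geometric progression, so `W` is Vandermonde up to
    -- unimodular row factors; `a` enters only through those factors.
    have h3 : W = Matrix.of fun i r => harmonic L a (x i) *
        vandermonde (fun i => (ZMod.stdAddChar (-x i) : ℂ)) i r := by
      ext i r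
      simp only [hW, submatrix_apply, harmonicMatrix, of_apply, id, vandermonde_apply]
      rw [harmonic_apply, harmonic_apply, ← AddChar.map_nsmul_eq_pow, ← AddChar.map_add_eq_mul]
      congr 1
      push_cast
      rw [nsmul_eq_mul]
      ring
    rw [h3, det_mul_column, det_vandermonde, norm_mul, norm_prod, norm_prod]
    rw [Finset.prod_eq_one fun i _ => by rw [harmonic_apply, norm_stdAddChar], one_mul]
    refine Finset.prod_congr rfl fun i _ => ?_
    rw [norm_prod]
    refine Finset.prod_congr rfl fun j _ => ?_
    rw [← chord_neg, chord_comm]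
    rfl
  have h4 : chordProduct s ^ 2 = ‖W.det‖ ^ 2 := by
    rw [chordProduct_sq, h2, ← prod_offDiag_eq_prod_Ioi_sq (fun i j => chord (x i) (x j))
      fun i j => chord_comm _ _]
    symm
    refine Finset.prod_bij (fun p _ => (x p.1, x p.2)) ?_ ?_ ?_ ?_
    · intro p hp
      exact Finset.mem_offDiag.2 ⟨(e p.1).2, (e p.2).2,
        fun h => (Finset.mem_offDiag.1 hp).2.2 (hxinj h)⟩
    · intro p _ q _ hpq
      exact Prod.ext (hxinj (congrArg Prod.fst hpq)) (hxinj (congrArg Prod.snd hpq))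
    · rintro ⟨i, j⟩ hij
      obtain ⟨hi, hj, hne⟩ := Finset.mem_offDiag.1 hij
      refine ⟨(e.symm ⟨i, hi⟩, e.symm ⟨j, hj⟩), Finset.mem_offDiag.2 ⟨Finset.mem_univ _,
        Finset.mem_univ _, fun h => hne ?_⟩, by simp [hx]⟩
      exact congrArg Subtype.val (e.symm.injective h)
    · intro p _
      rfl
  rw [h1, Matrix.mul_smul, det_smul, Fintype.card_fin, det_mul, det_conjTranspose, h4]
  push_cast
  rw [← Complex.mul_conj']
  rfl

lemma sum_principalMinor_harmonicKernel (hNL : N ≤ L) (a : ℤ) (A : Finset (ZMod L)) :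
    ∑ s : State L N with A ⊆ s.1, (L : ℝ)⁻¹ ^ N * chordProduct s.1 ^ 2 =
      principalMinor (harmonicKernel L N a) A := by
  have h := sum_principalMinor_eq (conjTranspose_mul_harmonicMatrix hNL a) A
  rw [← harmonicKernel_eq hNL, Fintype.card_fin] at h
  rw [← h]
  push_cast
  refine Finset.sum_bij (fun s _ => s.1) ?_ ?_ ?_ ?_
  · intro s hs
    exact Finset.mem_filter.2 ⟨Finset.mem_powersetCard.2 ⟨Finset.subset_univ _, s.2⟩,
      (Finset.mem_filter.1 hs).2⟩
  · intro s _ t _ hst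
    exact Subtype.ext hst
  · intro s hs
    obtain ⟨h1, h2⟩ := Finset.mem_filter.1 hs
    exact ⟨⟨s, (Finset.mem_powersetCard.1 h1).2⟩, Finset.mem_filter.2 ⟨Finset.mem_univ _, h2⟩, rfl⟩
  · intro s _
    rw [principalMinor_harmonicKernel hNL a s.2]
    push_cast
    rfl

/-- A measure of maximal entropy has determinantal one-time marginals. -/
theorem isDeterminantal_of_isMaximalEntropyMeasure (hN : 0 < N) (hNL : N < L)
    {μ : Measure (ℤ → State L N)} (hμ : IsMaximalEntropyMeasure (Jump L N) μ) (a : ℤ) :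
    IsDeterminantal μ (fun x => (x 0).1) (harmonicKernel L N a) := by
  intro A
  have := hμ.1.isProbabilityMeasure
  have hmarg := (isPerronData hN hNL).measureReal_state hμ
  have hL : (L : ℝ)⁻¹ ^ N ≠ 0 := pow_ne_zero _ (inv_ne_zero (by exact_mod_cast NeZero.ne L))
  -- The case `A = ∅` evaluates the partition function as `L ^ N`, matching the normalizations of
  -- the Parry law and of the minors.
  have hZ : (L : ℝ)⁻¹ ^ N * partitionFunction L N = 1 := by
    have h := sum_principalMinor_harmonicKernel hNL.le a ∅
    rw [principalMinor_empty] at h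
    simp only [Finset.empty_subset, Finset.filter_true] at h
    rw [partitionFunction, Finset.mul_sum]
    exact_mod_cast h
  have hset : {x : ℤ → State L N | A ⊆ (x 0).1} = (fun x : ℤ → State L N => x 0) ⁻¹'
      ((Finset.univ.filter fun s : State L N => A ⊆ s.1 : Finset (State L N)) : Set (State L N)) := by
    ext x
    simp
  have hsum : μ.real {x : ℤ → State L N | A ⊆ (x 0).1} =
      ∑ s : State L N with A ⊆ s.1, (L : ℝ)⁻¹ ^ N * chordProduct s.1 ^ 2 := by
    rw [hset, ← sum_measureReal_preimage_singleton _ fun s _ =>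
      measurable_pi_apply 0 (measurableSet_singleton s)]
    refine Finset.sum_congr rfl fun s _ => ?_
    rw [hmarg, eq_div_of_mul_eq (right_ne_zero_of_mul_eq_one hZ) hZ]
    ring
  rw [hsum]
  exact sum_principalMinor_harmonicKernel hNL.le a A

end Fourier

end ModifiedTASEP

end

theorem theorem1 (L N : ℕ) [NeZero L] (hN : 0 < N) (hNL : N < L) :
    Dynamics.coverEntropy ModifiedTASEP.shift
        (ModifiedTASEP.pathSpace (ModifiedTASEP.Jump L N)) =
      ((Real.log (Real.sin (Real.pi * N / L) / Real.sin (Real.pi / L)) : ℝ) : EReal) ∧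
    (∃! μ : MeasureTheory.Measure (ℤ → ModifiedTASEP.State L N),
      ModifiedTASEP.IsMaximalEntropyMeasure (ModifiedTASEP.Jump L N) μ) ∧
    ∀ μ : MeasureTheory.Measure (ℤ → ModifiedTASEP.State L N),
      ModifiedTASEP.IsMaximalEntropyMeasure (ModifiedTASEP.Jump L N) μ →
      ∀ a : ℤ, ModifiedTASEP.IsDeterminantal μ (fun x => (x 0).1)
        (ModifiedTASEP.harmonicKernel L N a) :=
  ⟨(ModifiedTASEP.isPerronData hN hNL).coverEntropy_eq,
    (ModifiedTASEP.isPerronData hN hNL).existsUnique_isMaximalEntropyMeasure,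
    fun _ hμ a => ModifiedTASEP.isDeterminantal_of_isMaximalEntropyMeasure hN hNL hμ a⟩
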